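/- Let the scalar field be $\mathbb R$ or $\mathbb C$ and let $L_p=L_p(0,1)$ with Lebesgue measure. For $2<p<\infty$ and a sequence $w=(w_n)_{n\in\mathbb N}$ of positive real numbers, let $X_{p,w}$ be the Banach space of all scalar sequences $x=(x_n)$ with $\sum|x_n|^p<\infty$ and $\sum|w_nx_n|^2<\infty$, with the norm $$\|x\|_{X_{p,w}}=\max\Big\{\Big(\sum|x_n|^p\Big)^{1/p},\ \Big(\sum|w_nx_n|^2\Big)^{1/2}\Big\}.$$ A subspace of a Banach space is complemented if it is the range of a bounded linear projection. A Banach space $X$ is an $\mathcal L_p$ space if there is a constant $1\le\lambda<\infty$ such that each finite-dimensional subspace $Z$ of $X$ is contained in a finite-dimensional subspace $Y$ of $X$ with $d(Y,\ell^p_n)\le\lambda$, where $n=\dim Y$ and $d(Y,\ell^p_n)=\inf\|S\|\,\|S^{-1}\|$, the infimum being over all isomorphisms $S:Y\to\ell^p_n$ (the Banach–Mazur distance). (1) Let $2<p<\infty$ and let $w=(w_n)$ be a sequence of positive real numbers. Then $X_{p,w}$ is isomorphic to a complemented subspace of $L_p$. If $\inf_n w_n=0$, then $X_{p,w}$ is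 an $\mathcal L_p$ space. In particular, if $\sum_{n:\,w_n<\varepsilon}w_n^{2p/(p-2)}=\infty$ for each $\varepsilon>0$, then $X_{p,w}$ is an $\mathcal L_p$ space. (2) There are constants $C_p$ ($1<p<\infty$), depending only on $p$ (and the scalar field), with $C_2=1$ and $C_p=C_q$ whenever $\frac1p+\frac1q=1$, such that the following holds for every $1<p<\infty$. Let $(f_n)_{n\in\mathbb N}$ be a sequence of independent symmetric three-valued random variables on $(0,1)$; that is, for each $n$ there is a scalar $a_n\ne0$ such that almost surely $f_n\in\{a_n,0,-a_n\}$, and $f_n$ takes the values $a_n$ and $-a_n$ with the same positive probability (the value $0$ may have probability zero). Then there is a bounded linear projection $P:L_p\to L_p$ whose range is the closed linear span of $\{f_n\}$ in $L_p$, with $\|P\|\le C_p$, and on $L_p\cap L_2$ the operator $P$ agrees with the orthogonal projection of $L_2$ onto the closed linear span of $\{f_n\}$ in $L_2$. -/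

import Mathlib

open MeasureTheory ProbabilityTheory
open scoped ENNReal

noncomputable section

/-! ### The sequence space `X_{p,w}` -/

/-- The sequences `x` of scalars with `∑ |x n| ^ p < ∞` and `∑ |w n * x n| ^ 2 < ∞`. -/
def xpwSubmodule (𝕜 : Type*) [RCLike 𝕜] (p : ℝ≥0∞) (w : ℕ → ℝ) : Submodule 𝕜 (ℕ → 𝕜) where
  carrier := {x | Memℓp x p ∧ Memℓp (fun n => (w n : 𝕜) * x n) 2}
  zero_mem' := by
    refine ⟨zero_memℓp, ?_⟩
    simpa using (zero_mem_ℓp' : Memℓp (fun _ : ℕ => (0 : 𝕜)) 2)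
  add_mem' := by
    intro x y hx hy
    refine ⟨hx.1.add hy.1, ?_⟩
    have h := hx.2.add hy.2
    convert h using 1
    funext n
    simp [mul_add]
  smul_mem' := by
    intro c x hx
    refine ⟨hx.1.const_smul c, ?_⟩
    have h := hx.2.const_smul c
    convert h using 1
    funext n
    simp [mul_left_comm]

/-- The space `X_{p,w}` of those sequences, which is given the norm
`max ((∑ |x n| ^ p) ^ (1 / p)) ((∑ |w n * x n| ^ 2) ^ (1 / 2))` below. -/
def Xpw (𝕜 : Type*) [RCLike 𝕜] (p : ℝ≥0∞) (w : ℕ → ℝ) : Type _ :=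
  xpwSubmodule 𝕜 p w

namespace Xpw

variable {𝕜 : Type*} [RCLike 𝕜] {p : ℝ≥0∞} {w : ℕ → ℝ}

instance : AddCommGroup (Xpw 𝕜 p w) :=
  inferInstanceAs (AddCommGroup (xpwSubmodule 𝕜 p w))

instance : Module 𝕜 (Xpw 𝕜 p w) :=
  inferInstanceAs (Module 𝕜 (xpwSubmodule 𝕜 p w))

/-- The sequence itself, as an element of `ℓ^p`. -/
def toLp (x : Xpw 𝕜 p w) : lp (fun _ : ℕ => 𝕜) p := ⟨x.1, x.2.1⟩

/-- The weighted sequence `n ↦ w n * x n`, as an element of `ℓ^2`. -/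
def toL2 (x : Xpw 𝕜 p w) : lp (fun _ : ℕ => 𝕜) 2 := ⟨fun n => (w n : 𝕜) * x.1 n, x.2.2⟩

theorem toLp_add (x y : Xpw 𝕜 p w) : (x + y).toLp = x.toLp + y.toLp := rfl

theorem toL2_add (x y : Xpw 𝕜 p w) : (x + y).toL2 = x.toL2 + y.toL2 := by
  ext n
  exact mul_add _ _ _

theorem toLp_smul (c : 𝕜) (x : Xpw 𝕜 p w) : (c • x).toLp = c • x.toLp := rfl

theorem toL2_smul (c : 𝕜) (x : Xpw 𝕜 p w) : (c • x).toL2 = c • x.toL2 := by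
  ext n
  exact mul_left_comm _ _ _

/-- The map `x ↦ (x, w x)` into the product of `ℓ^p` and `ℓ^2`. -/
def toProd : Xpw 𝕜 p w →ₗ[𝕜] lp (fun _ : ℕ => 𝕜) p × lp (fun _ : ℕ => 𝕜) 2 where
  toFun x := (x.toLp, x.toL2)
  map_add' x y := by rw [toLp_add, toL2_add]; rfl
  map_smul' c x := by rw [toLp_smul, toL2_smul]; rfl

theorem toProd_injective : Function.Injective (toProd : Xpw 𝕜 p w →ₗ[𝕜] _) := by
  intro x y h
  have h1 : x.toLp = y.toLp := congrArg Prod.fst h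
  exact Subtype.ext (congrArg (fun z : lp (fun _ : ℕ => 𝕜) p => (z : ℕ → 𝕜)) h1)

/-- The norm of `X_{p,w}`: the maximum of the `ℓ^p` norm and the weighted `ℓ^2` norm. -/
instance [Fact (1 ≤ p)] : NormedAddCommGroup (Xpw 𝕜 p w) :=
  AddGroupNorm.toNormedAddCommGroup
    { toFun := fun x => max ‖x.toLp‖ ‖x.toL2‖
      map_zero' := by
        change ‖toProd (0 : Xpw 𝕜 p w)‖ = 0
        rw [map_zero, norm_zero]
      add_le' := fun x y => by
        change ‖toProd (x + y)‖ ≤ ‖toProd x‖ + ‖toProd y‖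
        rw [map_add]
        exact norm_add_le _ _
      neg' := fun x => by
        change ‖toProd (-x)‖ = ‖toProd x‖
        rw [map_neg, norm_neg]
      eq_zero_of_map_eq_zero' := fun x hx => by
        change ‖toProd x‖ = 0 at hx
        exact toProd_injective (by rw [norm_eq_zero.1 hx, map_zero]) }

theorem norm_toProd [Fact (1 ≤ p)] (x : Xpw 𝕜 p w) : ‖toProd x‖ = ‖x‖ := rfl

instance [Fact (1 ≤ p)] : NormedSpace 𝕜 (Xpw 𝕜 p w) where
  norm_smul_le c x := by
    rw [← norm_toProd, ← norm_toProd, map_smul]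
    exact norm_smul_le _ _

theorem isometry_toProd [Fact (1 ≤ p)] : Isometry (toProd : Xpw 𝕜 p w →ₗ[𝕜] _) :=
  AddMonoidHomClass.isometry_of_norm toProd norm_toProd

/-- `X_{p,w}` is a Banach space. -/
instance [Fact (1 ≤ p)] : CompleteSpace (Xpw 𝕜 p w) := by
  refine (completeSpace_iff_isComplete_range isometry_toProd.isUniformInducing).2 ?_
  refine IsClosed.isComplete ?_
  have hr : Set.range (toProd : Xpw 𝕜 p w →ₗ[𝕜] _)
      = {u | ∀ n, u.2 n = (w n : 𝕜) * u.1 n} := by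
    ext u
    constructor
    · rintro ⟨x, rfl⟩ n
      rfl
    · intro hu
      have h2 : (fun n => (w n : 𝕜) * u.1 n) = u.2 := funext fun n => (hu n).symm
      refine ⟨⟨u.1, lp.memℓp u.1, ?_⟩, ?_⟩
      · rw [h2]
        exact lp.memℓp u.2
      · exact Prod.ext rfl (lp.ext h2)
  have hc : ∀ (q : ℝ≥0∞) [Fact (1 ≤ q)] (n : ℕ),
      Continuous fun u : lp (fun _ : ℕ => 𝕜) q => u n := fun q hq n =>
    (LipschitzWith.of_dist_le_mul (K := 1) fun u v => by
      have h := lp.norm_apply_le_norm (zero_lt_one.trans_le hq.out).ne' (u - v) n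
      simpa [dist_eq_norm] using h).continuous
  rw [hr, Set.ofPred_forall]
  exact isClosed_iInter fun n => isClosed_eq ((hc 2 n).comp continuous_snd)
    (continuous_const.mul ((hc p n).comp continuous_fst))

end Xpw

/-! ### Banach space notions -/

/-- The Banach-Mazur distance `inf ‖S‖ ‖S⁻¹‖` over all isomorphisms `S : E → F`
(it is `∞` if there are none). -/
def banachMazurDist (𝕜 : Type*) [RCLike 𝕜] (E F : Type*)
    [NormedAddCommGroup E] [NormedSpace 𝕜 E] [NormedAddCommGroup F] [NormedSpace 𝕜 F] : ℝ≥0∞ :=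
  ⨅ S : E ≃L[𝕜] F, ENNReal.ofReal (‖(S : E →L[𝕜] F)‖ * ‖(S.symm : F →L[𝕜] E)‖)

/-- `X` is an `ℒ_{p,c}` space: every finite-dimensional subspace `Z` lies in a finite-dimensional
subspace `Y` with `d(Y, ℓ^p_n) ≤ c`, where `n = dim Y`. -/
def IsScriptLpWith (𝕜 : Type*) [RCLike 𝕜] (p : ℝ≥0∞) [Fact (1 ≤ p)] (c : ℝ)
    (X : Type*) [NormedAddCommGroup X] [NormedSpace 𝕜 X] [CompleteSpace X] : Prop :=
  ∀ Z : Submodule 𝕜 X, FiniteDimensional 𝕜 Z →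
    ∃ Y : Submodule 𝕜 X, FiniteDimensional 𝕜 Y ∧ Z ≤ Y ∧
      banachMazurDist 𝕜 Y (PiLp p fun _ : Fin (Module.finrank 𝕜 Y) => 𝕜) ≤ ENNReal.ofReal c

/-- `X` is an `ℒ_p` space. -/
def IsScriptLp (𝕜 : Type*) [RCLike 𝕜] (p : ℝ≥0∞) [Fact (1 ≤ p)]
    (X : Type*) [NormedAddCommGroup X] [NormedSpace 𝕜 X] [CompleteSpace X] : Prop :=
  ∃ c : ℝ, 1 ≤ c ∧ IsScriptLpWith 𝕜 p c X

/-- `X` is isomorphic to a complemented subspace of `E`, that is, to the range of a bounded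
linear projection. -/
def IsomorphicToComplemented (𝕜 : Type*) [RCLike 𝕜] (X E : Type*)
    [NormedAddCommGroup X] [NormedSpace 𝕜 X] [NormedAddCommGroup E] [NormedSpace 𝕜 E] : Prop :=
  ∃ Y : Submodule 𝕜 E, Y.ClosedComplemented ∧ Nonempty (X ≃L[𝕜] Y)

/-- Condition `(*)`: for each `ε > 0`, the sum of `w n ^ (2p / (p - 2))` over the `n` with
`w n < ε` is infinite. -/
def ConditionStar (p : ℝ) (w : ℕ → ℝ) : Prop :=
  ∀ ε : ℝ, 0 < ε →
    ∑' n : {n : ℕ // w n < ε}, ENNReal.ofReal (w n ^ (2 * p / (p - 2))) = ∞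

/-! ### Random variables on the unit interval -/

/-- Lebesgue measure on `(0, 1)`. -/
def unitMeasure : Measure ℝ := volume.restrict (Set.Ioo 0 1)

instance : IsProbabilityMeasure unitMeasure := ⟨by simp [unitMeasure]⟩

/-- A symmetric three-valued random variable: almost surely its value is one of `a`, `0`, `-a`, where
`a ≠ 0`, and `a` and `-a` have the same positive probability (the value `0` may have
probability zero). -/
def IsSymmThreeValued {𝕜 : Type*} [RCLike 𝕜] (f : ℝ → 𝕜) : Prop :=
  Measurable f ∧ ∃ a : 𝕜, a ≠ 0 ∧
    (∀ᵐ t ∂unitMeasure, f t = a ∨ f t = 0 ∨ f t = -a) ∧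
    unitMeasure {t | f t = a} = unitMeasure {t | f t = -a} ∧
    0 < unitMeasure {t | f t = a}

/-- The closed linear span of (the classes of) the functions `f n` in `L^r(0, 1)`. -/
def closedSpan {𝕜 : Type*} [RCLike 𝕜] (f : ℕ → ℝ → 𝕜) (r : ℝ≥0∞) [Fact (1 ≤ r)] :
    Submodule 𝕜 (Lp 𝕜 r unitMeasure) :=
  (Submodule.span 𝕜
    {g : Lp 𝕜 r unitMeasure | ∃ n, (g : ℝ → 𝕜) =ᵐ[unitMeasure] f n}).topologicalClosure

instance {𝕜 : Type*} [RCLike 𝕜] (f : ℕ → ℝ → 𝕜) (r : ℝ≥0∞) [Fact (1 ≤ r)] :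
    CompleteSpace (closedSpan f r) :=
  (Submodule.isClosed_topologicalClosure _).completeSpace_coe

end

/-! Everything rests on independent symmetric variables `u n` with values in `{1, 0, -1}`. Put `e n
= u n / ‖u n‖_p` and `w n = ‖u n‖_2 / ‖u n‖_p`. For `p ≥ 2`, `rosenthal_inequality` bounds the `L^p`
norm of `∑ x n • e n` by a constant times the norm of `x` in `X_{p,w}`. Conversely, the coefficients
of an arbitrary `g` in `L^p` form an element of `X_{p,w}` of norm at most `‖g‖`: by duality this
follows from the subadditivity of `E|·|^q` on such sums for `q ≤ 2` (`sum_norm_signCoef_rpow_le`,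
used at the exponents `p` and `2`). So `coefOp` is a left inverse of `synthOp`, and `P = synthOp ∘
coefOp` is a bounded projection onto the closed span. Since `g - P g` has zero coefficients, it is
orthogonal to the span, and `P` is the restriction of the orthogonal projection of `L^2`. For `p <
2` the bound passes over from the conjugate exponent, because the orthogonal projection is
self-adjoint, and the operator is extended by density.

With `m n` the probability that `u n ≠ 0`, the weights are `m n ^ (1/2 - 1/p)`. As any masses in
`(0, 1]` can be realised on `(0, 1)`, every weight sequence in `(0, 1]` occurs. A diagonal operator
reduces a general `w` to `min w 1`, and `X_{p,w}` is complemented in `L^p`.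

For the `ℒ_p` property let `i` embed `X_{p,w}` in `L^p` with left inverse `q`. A finite-dimensional
`i(Z)` lies in the range of a `4`-isomorphic embedding `α` of some `ℓ^p_n`. The map `q ∘ α` loses
the component `(1 - i q) α`, which lies in a similar copy of some `ℓ^p_m`. When `inf w = 0`, the
space `X_{p,w}` contains `ℓ^p_m` isometrically on coordinates arbitrarily far out, so the lost
component can be stored there, almost disjointly from the range of `q ∘ α`. The resulting map is an
isomorphism with constants depending only on `‖i‖` and `‖q‖`, and its range still contains `Z`,
where nothing was lost. -/

noncomputable section

/-! ### Scalar inequalities for `‖s + x‖ ^ p + ‖s - x‖ ^ p` -/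

theorem Real.exp_le_one_add_add_sq_mul_exp_abs (x : ℝ) :
    Real.exp x ≤ 1 + x + x ^ 2 * Real.exp |x| := by
  have h := Complex.norm_exp_sub_sum_le_norm_mul_exp (x : ℂ) 2
  have e : Complex.exp x - ∑ m ∈ Finset.range 2, (x : ℂ) ^ m / (m.factorial : ℂ)
      = ((Real.exp x - (1 + x) : ℝ) : ℂ) := by
    simp [Finset.sum_range_succ]
  rw [e, Complex.norm_real, Complex.norm_real, Real.norm_eq_abs, Real.norm_eq_abs, sq_abs] at h
  linarith [le_abs_self (Real.exp x - (1 + x))]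

/-- A constant for the second order estimate of `‖s + x‖ ^ p + ‖s - x‖ ^ p`. -/
def secondOrderConst (p : ℝ) : ℝ := p / 2 + 9 * (p / 2) ^ 2 * Real.exp (3 * (p / 2)) + 2 ^ p

theorem secondOrderConst_pos {p : ℝ} (hp : 0 ≤ p) : 0 < secondOrderConst p := by
  unfold secondOrderConst
  positivity

section ScalarInequalities

variable {𝕜 : Type*} [RCLike 𝕜]

/-- From `u ^ 2 ≤ exp (u ^ 2 - 1)` one gets `u ^ p ≤ exp (p / 2 * (u ^ 2 - 1))`, which is expanded
to second order using `|u ^ 2 - 1| ≤ 3 * y`. The linear term is kept in `u ^ 2`, not `u`, so that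
the parallelogram law can evaluate it after averaging over signs. -/
theorem rpow_le_quadratic {p u y : ℝ} (hp : 2 ≤ p) (hu : 0 ≤ u) (hy : 0 ≤ y) (hy1 : y ≤ 1)
    (h : |u - 1| ≤ y) :
    u ^ p ≤ 1 + p / 2 * (u ^ 2 - 1) + 9 * (p / 2) ^ 2 * Real.exp (3 * (p / 2)) * y ^ 2 := by
  have h1 : |u ^ 2 - 1| ≤ 3 * y := by
    rw [show u ^ 2 - 1 = (u - 1) * (u + 1) by ring, abs_mul, abs_of_nonneg (by linarith : 0 ≤ u + 1)]
    have := (abs_le.1 h).2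
    nlinarith [abs_nonneg (u - 1)]
  have h2 : u ^ p ≤ Real.exp (p / 2 * (u ^ 2 - 1)) := by
    have : u ^ p = (u ^ 2) ^ (p / 2) := by
      rw [← Real.rpow_natCast, ← Real.rpow_mul hu]
      congr 1
      push_cast
      ring
    rw [this, mul_comm (p / 2), Real.exp_mul]
    refine Real.rpow_le_rpow (by positivity) ?_ (by linarith)
    linarith [Real.add_one_le_exp (u ^ 2 - 1)]
  have h3 := Real.exp_le_one_add_add_sq_mul_exp_abs (p / 2 * (u ^ 2 - 1))
  have h4 : (p / 2 * (u ^ 2 - 1)) ^ 2 ≤ 9 * (p / 2) ^ 2 * y ^ 2 := by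
    have : (u ^ 2 - 1) ^ 2 ≤ (3 * y) ^ 2 := sq_le_sq' (by linarith [(abs_le.1 h1).1])
      (abs_le.1 h1).2
    nlinarith [mul_le_mul_of_nonneg_left this (sq_nonneg (p / 2))]
  have h5 : Real.exp |p / 2 * (u ^ 2 - 1)| ≤ Real.exp (3 * (p / 2)) := by
    refine Real.exp_le_exp.2 ?_
    rw [abs_mul, abs_of_nonneg (by linarith : 0 ≤ p / 2), mul_comm]
    exact mul_le_mul_of_nonneg_right (by linarith) (by linarith)
  have h6 := mul_le_mul h4 h5 (Real.exp_pos _).le (by positivity)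
  calc u ^ p ≤ _ := h2.trans h3
    _ ≤ _ := by linarith

/-- If `‖s‖ < ‖x‖` the crude bound `(2 * ‖x‖) ^ p` suffices. Otherwise scale to `‖s‖ = 1` and add
the quadratic bounds for both signs; by the parallelogram law the linear terms sum to a multiple of
`‖x‖ ^ 2`. -/
theorem norm_add_rpow_add_norm_sub_rpow_le {p : ℝ} (hp : 2 ≤ p) (s x : 𝕜) :
    ‖s + x‖ ^ p + ‖s - x‖ ^ p
      ≤ 2 * (‖s‖ ^ p + secondOrderConst p * (‖s‖ ^ (p - 2) * ‖x‖ ^ 2 + ‖x‖ ^ p)) := by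
  have hp0 : 0 ≤ p := by linarith
  rcases lt_or_ge ‖s‖ ‖x‖ with hsx | hsx
  · have h1 : ‖s + x‖ ^ p ≤ 2 ^ p * ‖x‖ ^ p := by
      rw [← Real.mul_rpow (by norm_num) (norm_nonneg _)]
      exact Real.rpow_le_rpow (norm_nonneg _) (by linarith [norm_add_le s x]) hp0
    have h2 : ‖s - x‖ ^ p ≤ 2 ^ p * ‖x‖ ^ p := by
      rw [← Real.mul_rpow (by norm_num) (norm_nonneg _)]
      exact Real.rpow_le_rpow (norm_nonneg _) (by linarith [norm_sub_le s x]) hp0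
    have h3 : 2 ^ p * ‖x‖ ^ p ≤ secondOrderConst p * ‖x‖ ^ p := by
      refine mul_le_mul_of_nonneg_right ?_ (by positivity)
      unfold secondOrderConst
      have : 0 ≤ p / 2 + 9 * (p / 2) ^ 2 * Real.exp (3 * (p / 2)) := by positivity
      linarith
    have h4 : 0 ≤ ‖s‖ ^ p := by positivity
    have h5 : 0 ≤ secondOrderConst p * (‖s‖ ^ (p - 2) * ‖x‖ ^ 2) :=
      mul_nonneg (secondOrderConst_pos hp0).le (by positivity)
    linarith
  · rcases (norm_nonneg s).eq_or_lt with h0 | h0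
    · have hx : x = 0 := norm_le_zero_iff.1 (h0 ▸ hsx)
      have h5 : 0 ≤ secondOrderConst p * (‖s‖ ^ (p - 2) * ‖x‖ ^ 2 + ‖x‖ ^ p) :=
        mul_nonneg (secondOrderConst_pos hp0).le (by positivity)
      subst hx
      simp only [add_zero, sub_zero]
      simp only [norm_zero] at h5 ⊢
      linarith
    · set a := ‖s‖ with ha
      set y := ‖x‖ / a with hy
      have hy0 : 0 ≤ y := by positivity
      have hy1 : y ≤ 1 := (div_le_one h0).2 hsx
      have hx : ‖x‖ = a * y := by rw [hy]; field_simp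
      obtain ⟨u, hu⟩ : ∃ u, u = ‖s + x‖ / a := ⟨_, rfl⟩
      obtain ⟨v, hv⟩ : ∃ v, v = ‖s - x‖ / a := ⟨_, rfl⟩
      have hu' : ‖s + x‖ = a * u := by rw [hu]; field_simp
      have hv' : ‖s - x‖ = a * v := by rw [hv]; field_simp
      have hu0 : 0 ≤ u := by rw [hu]; positivity
      have hv0 : 0 ≤ v := by rw [hv]; positivity
      have hu1 : |u - 1| ≤ y := by
        have := abs_norm_sub_norm_le (s + x) s
        rw [add_sub_cancel_left, hu', ← ha, hx, show a * u - a = a * (u - 1) by ring, abs_mul,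
          abs_of_pos h0] at this
        exact le_of_mul_le_mul_left this h0
      have hv1 : |v - 1| ≤ y := by
        have := abs_norm_sub_norm_le (s - x) s
        rw [sub_sub_cancel_left, norm_neg, hv', ← ha, hx, show a * v - a = a * (v - 1) by ring,
          abs_mul, abs_of_pos h0] at this
        exact le_of_mul_le_mul_left this h0
      have huv : u ^ 2 + v ^ 2 = 2 + 2 * y ^ 2 := by
        have := parallelogram_law_with_norm 𝕜 s x
        rw [hu', hv', ← ha, hx] at this
        have h2 : a ^ 2 * (u ^ 2 + v ^ 2) = a ^ 2 * (2 + 2 * y ^ 2) := by linarith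
        exact mul_left_cancel₀ (by positivity) h2
      have h1 := rpow_le_quadratic hp hu0 hy0 hy1 hu1
      have h2 := rpow_le_quadratic hp hv0 hy0 hy1 hv1
      have hap : a ^ (p - 2) * (a * y) ^ 2 = a ^ p * y ^ 2 := by
        rw [mul_pow, ← mul_assoc, ← Real.rpow_add_natCast h0.ne']
        congr 2
        push_cast
        ring
      rw [hu', hv', hx, hap, Real.mul_rpow h0.le hu0, Real.mul_rpow h0.le hv0,
        Real.mul_rpow h0.le hy0]
      have h3 : u ^ p + v ^ p ≤ 2 * (1 + secondOrderConst p * (y ^ 2 + y ^ p)) := by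
        have h4 : 0 ≤ secondOrderConst p * y ^ p :=
          mul_nonneg (secondOrderConst_pos hp0).le (by positivity)
        have h5 : (p / 2 + 9 * (p / 2) ^ 2 * Real.exp (3 * (p / 2))) * y ^ 2
            ≤ secondOrderConst p * y ^ 2 := by
          refine mul_le_mul_of_nonneg_right ?_ (by positivity)
          unfold secondOrderConst
          have : (0 : ℝ) ≤ 2 ^ p := by positivity
          linarith
        have h6 : p / 2 * (u ^ 2 + v ^ 2) = p / 2 * (2 + 2 * y ^ 2) := by rw [huv]
        linarith
      have := mul_le_mul_of_nonneg_left h3 (by positivity : 0 ≤ a ^ p)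
      linarith

/-- Concavity of `t ^ (q / 2)` and the parallelogram law bound the mean by `(‖s‖ ^ 2 + ‖x‖ ^ 2) ^ (q
/ 2)`, and this power is subadditive. There is no loss of constant, which is what later makes
`coefOp` a contraction. -/
theorem norm_add_rpow_add_norm_sub_rpow_le_of_le_two {q : ℝ} (hq : 1 ≤ q) (hq2 : q ≤ 2)
    (s x : 𝕜) : ‖s + x‖ ^ q + ‖s - x‖ ^ q ≤ 2 * (‖s‖ ^ q + ‖x‖ ^ q) := by
  have key : ∀ a : ℝ, 0 ≤ a → a ^ q = (a ^ 2) ^ (q / 2) := fun a ha => by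
    rw [← Real.rpow_natCast, ← Real.rpow_mul ha]
    congr 1
    push_cast
    ring
  have h1 := (Real.concaveOn_rpow (p := q / 2) (by linarith) (by linarith)).2
    (Set.mem_Ici.2 (sq_nonneg ‖s + x‖))
    (Set.mem_Ici.2 (sq_nonneg ‖s - x‖))
    (by norm_num : (0 : ℝ) ≤ 1 / 2) (by norm_num : (0 : ℝ) ≤ 1 / 2) (by norm_num)
  have h2 := Real.rpow_add_le_add_rpow (sq_nonneg ‖s‖) (sq_nonneg ‖x‖)
    (by linarith : 0 ≤ q / 2) (by linarith)
  have h3 : (1 / 2 : ℝ) • ‖s + x‖ ^ 2 + (1 / 2 : ℝ) • ‖s - x‖ ^ 2 = ‖s‖ ^ 2 + ‖x‖ ^ 2 := by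
    have := parallelogram_law_with_norm 𝕜 s x
    simp only [smul_eq_mul]
    linarith
  beta_reduce at h1
  rw [h3, ← key _ (norm_nonneg _), ← key _ (norm_nonneg _), smul_eq_mul, smul_eq_mul] at h1
  rw [← key _ (norm_nonneg _), ← key _ (norm_nonneg _)] at h2
  linarith

end ScalarInequalities

/-! ### Moments of sums of independent symmetric variables -/

section IndependentSymmetric

variable {𝕜 : Type*} [RCLike 𝕜] {Ω : Type*} [MeasurableSpace Ω] {μ : Measure Ω}

theorem MeasureTheory.MemLp.integrable_norm_rpow_of_le [IsFiniteMeasure μ] {p r : ℝ} {f : Ω → 𝕜}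
    (hf : MemLp f (ENNReal.ofReal p) μ) (hr : 0 ≤ r) (hrp : r ≤ p) :
    Integrable (fun t => ‖f t‖ ^ r) μ := by
  have h : MemLp f (ENNReal.ofReal r) μ := hf.mono_exponent (ENNReal.ofReal_le_ofReal hrp)
  simpa [ENNReal.toReal_ofReal hr] using h.integrable_norm_rpow'

/-- A random variable with the same law as its negative. -/
def IsSymmetricRV (X : Ω → 𝕜) (μ : Measure Ω) : Prop :=
  μ.map X = μ.map (fun t => -X t)

/-- The pairs `(S, X)` and `(S, -X)` have the same law. This allows the scalar inequalities,
averaged over signs, to be integrated. -/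
theorem integral_norm_add_rpow_eq_sub [IsProbabilityMeasure μ] {S X : Ω → 𝕜} (hS : Measurable S)
    (hX : Measurable X) (hind : IndepFun S X μ) (hsymm : IsSymmetricRV X μ) (p : ℝ) :
    ∫ t, ‖S t + X t‖ ^ p ∂μ = ∫ t, ‖S t - X t‖ ^ p ∂μ := by
  have hind' : IndepFun S (fun t => -X t) μ := hind.comp measurable_id measurable_neg
  have h1 := (indepFun_iff_map_prod_eq_prod_map_map hS.aemeasurable hX.aemeasurable).1 hind
  have h2 := (indepFun_iff_map_prod_eq_prod_map_map hS.aemeasurable hX.neg.aemeasurable).1 hind'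
  have hsymm' : μ.map X = μ.map (-X) := hsymm
  have h3 : μ.map (fun t => (S t, X t)) = μ.map (fun t => (S t, -X t)) := by
    rw [h1, hsymm']
    exact h2.symm
  have hm : Measurable fun z : 𝕜 × 𝕜 => ‖z.1 + z.2‖ ^ p := by fun_prop
  have e1 := integral_map (μ := μ) (φ := fun t => (S t, X t)) (by fun_prop)
    hm.aestronglyMeasurable
  have e2 := integral_map (μ := μ) (φ := fun t => (S t, -X t)) (by fun_prop)
    hm.aestronglyMeasurable
  rw [h3, e2] at e1
  simpa [sub_eq_add_neg] using e1.symm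

theorem two_mul_integral_norm_add_rpow [IsProbabilityMeasure μ] {S X : Ω → 𝕜} (hS : Measurable S)
    (hX : Measurable X) (hind : IndepFun S X μ) (hsymm : IsSymmetricRV X μ) {p : ℝ} (hp : 0 ≤ p)
    (hSp : MemLp S (ENNReal.ofReal p) μ) (hXp : MemLp X (ENNReal.ofReal p) μ) :
    2 * ∫ t, ‖S t + X t‖ ^ p ∂μ = ∫ t, (‖S t + X t‖ ^ p + ‖S t - X t‖ ^ p) ∂μ := by
  have i1 : Integrable (fun t => ‖S t + X t‖ ^ p) μ :=
    (hSp.add hXp).integrable_norm_rpow_of_le hp le_rfl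
  have i2 : Integrable (fun t => ‖S t - X t‖ ^ p) μ :=
    (hSp.sub hXp).integrable_norm_rpow_of_le hp le_rfl
  rw [integral_add i1 i2, ← integral_norm_add_rpow_eq_sub hS hX hind hsymm]
  ring

theorem integral_norm_add_rpow_le_of_le_two [IsProbabilityMeasure μ] {S X : Ω → 𝕜}
    (hS : Measurable S) (hX : Measurable X) (hind : IndepFun S X μ) (hsymm : IsSymmetricRV X μ)
    {q : ℝ} (hq : 1 ≤ q) (hq2 : q ≤ 2)
    (hSp : MemLp S (ENNReal.ofReal q) μ) (hXp : MemLp X (ENNReal.ofReal q) μ) :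
    ∫ t, ‖S t + X t‖ ^ q ∂μ ≤ ∫ t, ‖S t‖ ^ q ∂μ + ∫ t, ‖X t‖ ^ q ∂μ := by
  have hq0 : 0 ≤ q := by linarith
  have h1 := two_mul_integral_norm_add_rpow hS hX hind hsymm hq0 hSp hXp
  have iS := hSp.integrable_norm_rpow_of_le hq0 le_rfl
  have iX := hXp.integrable_norm_rpow_of_le hq0 le_rfl
  have h2 : ∫ t, (‖S t + X t‖ ^ q + ‖S t - X t‖ ^ q) ∂μ
      ≤ ∫ t, 2 * (‖S t‖ ^ q + ‖X t‖ ^ q) ∂μ :=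
    integral_mono (((hSp.add hXp).integrable_norm_rpow_of_le hq0 le_rfl).add
      ((hSp.sub hXp).integrable_norm_rpow_of_le hq0 le_rfl)) ((iS.add iX).const_mul 2)
      fun t => norm_add_rpow_add_norm_sub_rpow_le_of_le_two hq hq2 _ _
  rw [integral_const_mul, integral_add iS iX] at h2
  linarith

theorem integral_norm_add_rpow_le [IsProbabilityMeasure μ] {S X : Ω → 𝕜} (hS : Measurable S)
    (hX : Measurable X) (hind : IndepFun S X μ) (hsymm : IsSymmetricRV X μ) {p : ℝ} (hp : 2 ≤ p)
    (hSp : MemLp S (ENNReal.ofReal p) μ) (hXp : MemLp X (ENNReal.ofReal p) μ) :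
    ∫ t, ‖S t + X t‖ ^ p ∂μ ≤ ∫ t, ‖S t‖ ^ p ∂μ + secondOrderConst p *
      ((∫ t, ‖S t‖ ^ (p - 2) ∂μ) * (∫ t, ‖X t‖ ^ 2 ∂μ) + ∫ t, ‖X t‖ ^ p ∂μ) := by
  have hp0 : 0 ≤ p := by linarith
  have h1 := two_mul_integral_norm_add_rpow hS hX hind hsymm hp0 hSp hXp
  have iS := hSp.integrable_norm_rpow_of_le hp0 le_rfl
  have iX := hXp.integrable_norm_rpow_of_le hp0 le_rfl
  have iS2 := hSp.integrable_norm_rpow_of_le (r := p - 2) (by linarith) (by linarith)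
  have iX2 : Integrable (fun t => ‖X t‖ ^ 2) μ := by
    have := hXp.integrable_norm_rpow_of_le (r := 2) (by norm_num) hp
    simpa using this
  have hind2 : IndepFun (fun t => ‖S t‖ ^ (p - 2)) (fun t => ‖X t‖ ^ 2) μ :=
    hind.comp (φ := fun z : 𝕜 => ‖z‖ ^ (p - 2)) (ψ := fun z : 𝕜 => ‖z‖ ^ 2)
      (by fun_prop) (by fun_prop)
  have iSX : Integrable (fun t => ‖S t‖ ^ (p - 2) * ‖X t‖ ^ 2) μ := hind2.integrable_mul iS2 iX2
  have eSX := hind2.integral_fun_mul_eq_mul_integral iS2.aestronglyMeasurable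
    iX2.aestronglyMeasurable
  have h2 : ∫ t, (‖S t + X t‖ ^ p + ‖S t - X t‖ ^ p) ∂μ
      ≤ ∫ t, 2 * (‖S t‖ ^ p + secondOrderConst p *
        (‖S t‖ ^ (p - 2) * ‖X t‖ ^ 2 + ‖X t‖ ^ p)) ∂μ :=
    integral_mono (((hSp.add hXp).integrable_norm_rpow_of_le hp0 le_rfl).add
      ((hSp.sub hXp).integrable_norm_rpow_of_le hp0 le_rfl))
      ((iS.add ((iSX.add iX).const_mul _)).const_mul 2)
      fun t => norm_add_rpow_add_norm_sub_rpow_le hp _ _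
  have iR : Integrable (fun t => ‖S t‖ ^ (p - 2) * ‖X t‖ ^ 2 + ‖X t‖ ^ p) μ := iSX.add iX
  rw [integral_const_mul, integral_add iS (iR.const_mul _), integral_const_mul,
    integral_add iSX iX, eSX] at h2
  linarith

/-- Jensen's inequality for the concave power `t ^ ((p - 2) / p)`. -/
theorem integral_norm_rpow_sub_two_le [IsProbabilityMeasure μ] {S : Ω → 𝕜} {p : ℝ} (hp : 2 ≤ p)
    (hSp : MemLp S (ENNReal.ofReal p) μ) :
    ∫ t, ‖S t‖ ^ (p - 2) ∂μ ≤ (∫ t, ‖S t‖ ^ p ∂μ) ^ ((p - 2) / p) := by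
  have hp0 : 0 < p := by linarith
  have hθ : 0 ≤ (p - 2) / p := div_nonneg (by linarith) hp0.le
  have hθ1 : (p - 2) / p ≤ 1 := (div_le_one hp0).2 (by linarith)
  have e : ∀ t, (‖S t‖ ^ p) ^ ((p - 2) / p) = ‖S t‖ ^ (p - 2) := fun t => by
    rw [← Real.rpow_mul (norm_nonneg _)]
    congr 1
    field_simp
  have := (Real.concaveOn_rpow hθ hθ1).le_map_integral (μ := μ) (f := fun t => ‖S t‖ ^ p)
    (Real.continuous_rpow_const hθ).continuousOn isClosed_Ici
    (Filter.Eventually.of_forall fun t => Set.mem_Ici.2 (by positivity))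
    (hSp.integrable_norm_rpow_of_le hp0.le le_rfl)
    (by
      simp only [Function.comp_def, e]
      exact hSp.integrable_norm_rpow_of_le (by linarith) (by linarith))
  simpa only [e] using this

variable {Y : ℕ → Ω → 𝕜}

theorem integral_norm_sum_rpow_le_of_le_two [IsProbabilityMeasure μ]
    (hm : ∀ n, Measurable (Y n)) (hind : iIndepFun Y μ) (hsymm : ∀ n, IsSymmetricRV (Y n) μ)
    {q : ℝ} (hq : 1 ≤ q) (hq2 : q ≤ 2) (hY : ∀ n, MemLp (Y n) (ENNReal.ofReal q) μ)
    (F : Finset ℕ) :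
    ∫ t, ‖∑ n ∈ F, Y n t‖ ^ q ∂μ ≤ ∑ n ∈ F, ∫ t, ‖Y n t‖ ^ q ∂μ := by
  induction F using Finset.induction_on with
  | empty => simp [Real.zero_rpow (by linarith : q ≠ 0)]
  | insert a F ha ih =>
    have hi := hind.indepFun_finsetSum_of_notMem hm ha
    have hS : ∑ n ∈ F, Y n = fun t => ∑ n ∈ F, Y n t := by
      ext t
      simp
    rw [hS] at hi
    have h1 := integral_norm_add_rpow_le_of_le_two (by fun_prop) (hm a) hi (hsymm a) hq hq2
      (memLp_finsetSum F fun n _ => hY n) (hY a)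
    simp only [Finset.sum_insert ha]
    simp only [add_comm (Y a _)]
    linarith

/-- The constant of Rosenthal's inequality. -/
def rosenthalConst (p : ℝ) : ℝ :=
  2 * secondOrderConst p + (2 * secondOrderConst p) ^ (p / 2)

theorem rosenthalConst_pos {p : ℝ} (hp : 0 ≤ p) : 0 < rosenthalConst p := by
  have := secondOrderConst_pos hp
  unfold rosenthalConst
  positivity

/-- Rosenthal's inequality for sums of independent symmetric random variables. -/
theorem rosenthal_inequality [IsProbabilityMeasure μ]
    (hm : ∀ n, Measurable (Y n)) (hind : iIndepFun Y μ) (hsymm : ∀ n, IsSymmetricRV (Y n) μ)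
    {p : ℝ} (hp : 2 ≤ p) (hY : ∀ n, MemLp (Y n) (ENNReal.ofReal p) μ)
    (F : Finset ℕ) {R : ℝ} (hR : 0 ≤ R) (hRp : ∑ n ∈ F, ∫ t, ‖Y n t‖ ^ p ∂μ ≤ R ^ p)
    (hR2 : ∑ n ∈ F, ∫ t, ‖Y n t‖ ^ 2 ∂μ ≤ R ^ 2) :
    ∫ t, ‖∑ n ∈ F, Y n t‖ ^ p ∂μ ≤ rosenthalConst p * R ^ p := by
  have hp0 : 0 < p := by linarith
  set C := secondOrderConst p with hC
  have hC0 : 0 < C := secondOrderConst_pos hp0.le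
  have hθ : 0 ≤ (p - 2) / p := div_nonneg (by linarith) hp0.le
  -- Maximising over all subsets of `F` gives one number `M` that dominates the moment of every
  -- partial sum met when terms are added one at a time, so no maximal inequality is needed.
  obtain ⟨H, hHF, hH⟩ := Finset.exists_max_image F.powerset
    (fun G => ∫ t, ‖∑ n ∈ G, Y n t‖ ^ p ∂μ) ⟨∅, by simp⟩
  set M := ∫ t, ‖∑ n ∈ H, Y n t‖ ^ p ∂μ with hM
  have hM0 : 0 ≤ M := integral_nonneg fun t => by positivity
  have key : ∀ G ⊆ F, ∫ t, ‖∑ n ∈ G, Y n t‖ ^ p ∂μ ≤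
      C * (M ^ ((p - 2) / p) * ∑ n ∈ G, ∫ t, ‖Y n t‖ ^ 2 ∂μ
        + ∑ n ∈ G, ∫ t, ‖Y n t‖ ^ p ∂μ) := by
    intro G
    induction G using Finset.induction_on with
    | empty => simp [Real.zero_rpow hp0.ne']
    | insert a G ha ih =>
      intro hG
      have hGF : G ⊆ F := (Finset.subset_insert a G).trans hG
      have hi := hind.indepFun_finsetSum_of_notMem hm ha
      have hS : ∑ n ∈ G, Y n = fun t => ∑ n ∈ G, Y n t := by
        ext t
        simp
      rw [hS] at hi
      have hSp : MemLp (fun t => ∑ n ∈ G, Y n t) (ENNReal.ofReal p) μ :=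
        memLp_finsetSum G fun n _ => hY n
      have h1 := integral_norm_add_rpow_le (by fun_prop) (hm a) hi (hsymm a) hp hSp (hY a)
      have h2 := (integral_norm_rpow_sub_two_le hp hSp).trans
        (Real.rpow_le_rpow (integral_nonneg fun t => by positivity)
          (hH G (Finset.mem_powerset.2 hGF)) hθ)
      have h3 : 0 ≤ ∫ t, ‖Y a t‖ ^ 2 ∂μ := integral_nonneg fun t => by positivity
      have h4 := mul_le_mul_of_nonneg_left (mul_le_mul_of_nonneg_right h2 h3) hC0.le
      have h5 := ih hGF
      simp only [Finset.sum_insert ha]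
      simp only [add_comm (Y a _)]
      linarith
  have h1 := key H (Finset.mem_powerset.1 hHF)
  have hHF' := Finset.mem_powerset.1 hHF
  have h2 : ∑ n ∈ H, ∫ t, ‖Y n t‖ ^ 2 ∂μ ≤ R ^ 2 :=
    (Finset.sum_le_sum_of_subset_of_nonneg hHF' fun _ _ _ =>
      integral_nonneg fun t => by positivity).trans hR2
  have h3 : ∑ n ∈ H, ∫ t, ‖Y n t‖ ^ p ∂μ ≤ R ^ p :=
    (Finset.sum_le_sum_of_subset_of_nonneg hHF' fun _ _ _ =>
      integral_nonneg fun t => by positivity).trans hRp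
  have h4 : M ≤ C * (M ^ ((p - 2) / p) * R ^ 2) + C * R ^ p := by
    refine h1.trans ?_
    rw [← mul_add]
    have : 0 ≤ M ^ ((p - 2) / p) := by positivity
    gcongr
  refine (hH F (Finset.mem_powerset_self F)).trans ?_
  have hRp0 : 0 ≤ R ^ p := by positivity
  have e : rosenthalConst p * R ^ p = 2 * C * R ^ p + (2 * C) ^ (p / 2) * R ^ p := by
    rw [rosenthalConst]; ring
  rw [e]
  have hA : 0 ≤ 2 * C * R ^ p := by positivity
  have hB : 0 ≤ (2 * C) ^ (p / 2) * R ^ p := by positivity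
  -- In `M ≤ C * M ^ (1 - 2 / p) * R ^ 2 + C * R ^ p` either the last term is at least `M / 2`, or
  -- it is absorbed and dividing by the power of `M` gives `M ^ (2 / p) ≤ 2 * C * R ^ 2`.
  rcases le_or_gt M (2 * C * R ^ p) with h5 | h5
  · exact h5.trans (le_add_of_nonneg_right hB)
  · have hMpos : 0 < M := hA.trans_lt h5
    have h6 : M ≤ 2 * C * R ^ 2 * M ^ ((p - 2) / p) := by linarith
    have h7 : M ^ (2 / p) ≤ 2 * C * R ^ 2 := by
      have h8 : M = M ^ (2 / p) * M ^ ((p - 2) / p) := by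
        rw [← Real.rpow_add hMpos, ← add_div, show 2 + (p - 2) = p by ring, div_self hp0.ne',
          Real.rpow_one]
      have h9 : 0 < M ^ ((p - 2) / p) := by positivity
      nth_rewrite 1 [h8] at h6
      exact le_of_mul_le_mul_right h6 h9
    have h10 := Real.rpow_le_rpow (by positivity) h7 (by positivity : 0 ≤ p / 2)
    rw [← Real.rpow_mul hM0, show 2 / p * (p / 2) = 1 by field_simp, Real.rpow_one,
      Real.mul_rpow (by positivity) (by positivity)] at h10
    have e2 : (R ^ 2) ^ (p / 2) = R ^ p := by
      rw [← Real.rpow_natCast, ← Real.rpow_mul hR]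
      congr 1
      push_cast
      ring
    rw [e2] at h10
    linarith

end IndependentSymmetric

/-! ### Sign systems and their coefficients -/

section SignSystem

variable {𝕜 : Type*} [RCLike 𝕜] {Ω : Type*} [MeasurableSpace Ω] {μ : Measure Ω}

/-- Independent symmetric random variables with values in `{1, 0, -1}`, none of them null. -/
structure IsSignSystem (u : ℕ → Ω → 𝕜) (μ : Measure Ω) : Prop where
  measurable : ∀ n, Measurable (u n)
  mem : ∀ n, ∀ᵐ t ∂μ, u n t = 1 ∨ u n t = 0 ∨ u n t = -1
  symm : ∀ n, IsSymmetricRV (u n) μ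
  indep : iIndepFun u μ
  pos : ∀ n, 0 < ∫ t, ‖u n t‖ ∂μ

/-- The probability that the `n`-th variable of a sign system does not vanish. -/
def signMass (u : ℕ → Ω → 𝕜) (μ : Measure Ω) (n : ℕ) : ℝ := ∫ t, ‖u n t‖ ∂μ

/-- The coefficients of `g` with respect to a sign system. -/
def signCoef (u : ℕ → Ω → 𝕜) (μ : Measure Ω) (g : Ω → 𝕜) (n : ℕ) : 𝕜 :=
  (((signMass u μ n)⁻¹ : ℝ) : 𝕜) * ∫ t, g t * u n t ∂μ

theorem IsSymmetricRV.const_mul {X : Ω → 𝕜} (h : IsSymmetricRV X μ) (hX : Measurable X) (c : 𝕜) :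
    IsSymmetricRV (fun t => c * X t) μ := by
  have hm : Measurable fun z : 𝕜 => c * z := by fun_prop
  have h1 : μ.map (fun t => c * X t) = (μ.map X).map (fun z => c * z) :=
    (Measure.map_map hm hX).symm
  have h2 : μ.map (fun t => c * -X t) = (μ.map (fun t => -X t)).map (fun z => c * z) :=
    (Measure.map_map hm hX.neg).symm
  unfold IsSymmetricRV at h ⊢
  simp only [mul_neg] at h2
  rw [h1, h2, h]

theorem IsSymmetricRV.integral_eq_zero {X : Ω → 𝕜} (h : IsSymmetricRV X μ) (hX : Measurable X) :
    ∫ t, X t ∂μ = 0 := by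
  have h1 := integral_map (μ := μ) hX.aemeasurable (f := fun z : 𝕜 => z)
    measurable_id.aestronglyMeasurable
  have h2 := integral_map (μ := μ) hX.neg.aemeasurable (f := fun z : 𝕜 => z)
    measurable_id.aestronglyMeasurable
  have h' : μ.map X = μ.map (-X) := h
  rw [← h', h1] at h2
  simp only [Pi.neg_apply, integral_neg] at h2
  exact self_eq_neg.1 h2

namespace IsSignSystem

variable {u : ℕ → Ω → 𝕜}

theorem norm_le_one (hu : IsSignSystem u μ) (n : ℕ) : ∀ᵐ t ∂μ, ‖u n t‖ ≤ 1 := by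
  filter_upwards [hu.mem n] with t ht
  rcases ht with h | h | h <;> simp [h]

theorem norm_rpow_eq (hu : IsSignSystem u μ) (n : ℕ) {r : ℝ} (hr : r ≠ 0) : ∀ᵐ t ∂μ, ‖u n t‖ ^ r = ‖u n t‖ := by
  filter_upwards [hu.mem n] with t ht
  rcases ht with h | h | h <;> simp [h, Real.zero_rpow hr]

theorem mul_self_eq (hu : IsSignSystem u μ) (n : ℕ) : ∀ᵐ t ∂μ, u n t * u n t = ((‖u n t‖ : ℝ) : 𝕜) := by
  filter_upwards [hu.mem n] with t ht
  rcases ht with h | h | h <;> simp [h]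

theorem star_eq (hu : IsSignSystem u μ) (n : ℕ) : ∀ᵐ t ∂μ, (starRingEnd 𝕜) (u n t) = u n t := by
  filter_upwards [hu.mem n] with t ht
  rcases ht with h | h | h <;> simp [h]

theorem signMass_pos (hu : IsSignSystem u μ) (n : ℕ) : 0 < signMass u μ n := hu.pos n

/-- Almost surely `‖u n‖` is `0` or `1`, so all its nonzero powers have the same integral; a single
mass governs every `L^r` norm. -/
theorem integral_norm_const_mul_rpow (hu : IsSignSystem u μ) (n : ℕ) (c : 𝕜) {r : ℝ} (hr : r ≠ 0) :
    ∫ t, ‖c * u n t‖ ^ r ∂μ = ‖c‖ ^ r * signMass u μ n := by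
  rw [signMass, ← integral_const_mul]
  refine integral_congr_ae ?_
  filter_upwards [hu.norm_rpow_eq n hr] with t ht
  rw [norm_mul, Real.mul_rpow (norm_nonneg _) (norm_nonneg _), ht]

theorem iIndepFun_const_mul (hu : IsSignSystem u μ) (b : ℕ → 𝕜) : iIndepFun (fun n t => b n * u n t) μ :=
  hu.indep.comp (fun n z => b n * z) fun n => by fun_prop

theorem integral_mul_eq (hu : IsSignSystem u μ) (i j : ℕ) :
    ∫ t, u i t * u j t ∂μ = if i = j then ((signMass u μ j : ℝ) : 𝕜) else 0 := by
  split_ifs with h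
  · subst h
    rw [integral_congr_ae (hu.mul_self_eq i), integral_ofReal, signMass]
  · rw [(hu.indep.indepFun h).integral_fun_mul_eq_mul_integral
      (hu.measurable i).aestronglyMeasurable (hu.measurable j).aestronglyMeasurable,
      (hu.symm i).integral_eq_zero (hu.measurable i), zero_mul]

theorem integrable_mul (hu : IsSignSystem u μ) {g : Ω → 𝕜} (hg : Integrable g μ) (n : ℕ) :
    Integrable (fun t => g t * u n t) μ :=
  hg.mul_bdd (hu.measurable n).aestronglyMeasurable (hu.norm_le_one n)

theorem signMass_mul_signCoef (hu : IsSignSystem u μ) (g : Ω → 𝕜) (n : ℕ) :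
    ((signMass u μ n : ℝ) : 𝕜) * signCoef u μ g n = ∫ t, g t * u n t ∂μ := by
  rw [signCoef, ← mul_assoc, ← RCLike.ofReal_mul, mul_inv_cancel₀ (hu.signMass_pos n).ne',
    RCLike.ofReal_one, one_mul]

variable [IsProbabilityMeasure μ]

theorem memLp (hu : IsSignSystem u μ) (n : ℕ) (p : ℝ≥0∞) : MemLp (u n) p μ :=
  MemLp.of_bound (hu.measurable n).aestronglyMeasurable 1 (hu.norm_le_one n)

/-- Duality: `g` is tested against the combination `h` of the `u n` that is extremal for its
coefficients. Then `∫ g * h` is the left side `S`, while `∫ ‖h‖ ^ q ≤ S` by subadditivity for the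
conjugate exponent `q ≤ 2`. Hölder gives `S ≤ ‖g‖_p * S ^ (1 / q)`. For `p = 2` this is Bessel's
inequality. -/
theorem sum_norm_signCoef_rpow_le (hu : IsSignSystem u μ) {g : Ω → 𝕜} {p : ℝ} (hp : 2 ≤ p)
    (hg : MemLp g (ENNReal.ofReal p) μ) (F : Finset ℕ) :
    ∑ n ∈ F, ‖signCoef u μ g n‖ ^ p * signMass u μ n ≤ ∫ t, ‖g t‖ ^ p ∂μ := by
  set c := signCoef u μ g with hc
  set S := ∑ n ∈ F, ‖c n‖ ^ p * signMass u μ n with hS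
  have hp0 : 0 < p := by linarith
  have hpq := Real.HolderConjugate.conjExponent (by linarith : 1 < p)
  set q := p.conjExponent
  have hq1 : 1 ≤ q := hpq.symm.lt.le
  have hq2 : q ≤ 2 := by
    have := hpq.sub_one_mul_conj
    have h1 := hpq.symm.lt
    nlinarith
  have hS0 : 0 ≤ S := Finset.sum_nonneg fun n _ =>
    mul_nonneg (by positivity) (hu.signMass_pos n).le
  have hG0 : 0 ≤ ∫ t, ‖g t‖ ^ p ∂μ := integral_nonneg fun t => by positivity
  rcases hS0.eq_or_lt with h0 | h0
  · rwa [← h0]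
  set b : ℕ → 𝕜 := fun n => ((‖c n‖ ^ (p - 2) : ℝ) : 𝕜) * (starRingEnd 𝕜) (c n) with hb
  have hbc : ∀ n, b n * c n = ((‖c n‖ ^ p : ℝ) : 𝕜) := fun n => by
    rw [hb, mul_assoc, RCLike.conj_mul, ← RCLike.ofReal_pow, ← RCLike.ofReal_mul]
    rcases eq_or_ne (c n) 0 with h | h
    · simp [h, Real.zero_rpow hp0.ne']
    · rw [← Real.rpow_add_natCast (norm_ne_zero_iff.2 h)]
      norm_num
  have hbn : ∀ n, ‖b n‖ ^ q = ‖c n‖ ^ p := fun n => by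
    have h1 : ‖b n‖ = ‖c n‖ ^ (p - 1) := by
      rw [hb, norm_mul, RCLike.norm_conj, RCLike.norm_ofReal, abs_of_nonneg (by positivity)]
      rcases eq_or_ne (c n) 0 with h | h
      · simp [h, Real.zero_rpow (by linarith : p - 1 ≠ 0)]
      · rw [← Real.rpow_add_one (norm_ne_zero_iff.2 h)]
        congr 1
        ring
    rw [h1, ← Real.rpow_mul (norm_nonneg _), hpq.sub_one_mul_conj]
  set h : Ω → 𝕜 := fun t => ∑ n ∈ F, b n * u n t with hh
  have hhq : MemLp h (ENNReal.ofReal q) μ :=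
    memLp_finsetSum F fun n _ => (hu.memLp n _).const_mul (b n)
  have hgi : Integrable g μ := hg.integrable (by simpa using (by linarith : 1 ≤ p))
  have e1 : ∫ t, g t * h t ∂μ = ((S : ℝ) : 𝕜) := by
    have : ∀ t, g t * h t = ∑ n ∈ F, b n * (g t * u n t) := fun t => by
      rw [hh, Finset.mul_sum]
      exact Finset.sum_congr rfl fun n _ => by ring
    simp only [this]
    rw [integral_finsetSum _ fun n _ => (hu.integrable_mul hgi n).const_mul _, hS,
      RCLike.ofReal_sum]
    refine Finset.sum_congr rfl fun n _ => ?_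
    rw [integral_const_mul, ← hu.signMass_mul_signCoef, RCLike.ofReal_mul, ← hbc]
    ring
  have e2 : S ≤ ∫ t, ‖g t‖ * ‖h t‖ ∂μ := by
    calc S = ‖∫ t, g t * h t ∂μ‖ := by rw [e1, RCLike.norm_ofReal, abs_of_nonneg hS0]
      _ ≤ ∫ t, ‖g t * h t‖ ∂μ := norm_integral_le_integral_norm _
      _ = _ := by simp only [norm_mul]
  have e3 : ∫ t, ‖h t‖ ^ q ∂μ ≤ S := by
    refine (integral_norm_sum_rpow_le_of_le_two (Y := fun n t => b n * u n t)
      (fun n => (hu.measurable n).const_mul _) (hu.iIndepFun_const_mul b)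
      (fun n => (hu.symm n).const_mul (hu.measurable n) _) hq1 hq2
      (fun n => (hu.memLp n _).const_mul (b n)) F).trans (le_of_eq ?_)
    refine Finset.sum_congr rfl fun n _ => ?_
    rw [hu.integral_norm_const_mul_rpow n _ (by linarith), hbn]
  have e4 := e2.trans (integral_mul_norm_le_Lp_mul_Lq hpq hg hhq)
  have e5 : S ≤ (∫ t, ‖g t‖ ^ p ∂μ) ^ (1 / p) * S ^ (1 / q) :=
    e4.trans (mul_le_mul_of_nonneg_left (Real.rpow_le_rpow (integral_nonneg fun t => by positivity)
      e3 (by positivity)) (by positivity))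
  have e6 : S = S ^ (1 / p) * S ^ (1 / q) := by
    rw [← Real.rpow_add h0, one_div, one_div, hpq.inv_add_inv_eq_one, Real.rpow_one]
  nth_rewrite 1 [e6] at e5
  have e7 := le_of_mul_le_mul_right e5 (by positivity)
  exact (Real.rpow_le_rpow_iff hS0 hG0 (by positivity)).1 e7

theorem integral_norm_sum_rpow_le (hu : IsSignSystem u μ) {p : ℝ} (hp : 2 ≤ p) (b : ℕ → 𝕜) (F : Finset ℕ) {R : ℝ}
    (hR : 0 ≤ R) (hRp : ∑ n ∈ F, ‖b n‖ ^ p * signMass u μ n ≤ R ^ p)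
    (hR2 : ∑ n ∈ F, ‖b n‖ ^ 2 * signMass u μ n ≤ R ^ 2) :
    ∫ t, ‖∑ n ∈ F, b n * u n t‖ ^ p ∂μ ≤ rosenthalConst p * R ^ p := by
  refine rosenthal_inequality (Y := fun n t => b n * u n t)
      (fun n => (hu.measurable n).const_mul _) (hu.iIndepFun_const_mul b)
      (fun n => (hu.symm n).const_mul (hu.measurable n) _) hp
      (fun n => (hu.memLp n _).const_mul (b n)) F hR ?_ ?_
  · simpa only [hu.integral_norm_const_mul_rpow _ _ (by linarith : p ≠ 0)] using hRp
  · have : ∀ n, ∫ t, ‖b n * u n t‖ ^ 2 ∂μ = ‖b n‖ ^ 2 * signMass u μ n := fun n => by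
      simpa using hu.integral_norm_const_mul_rpow n (b n) (two_ne_zero (α := ℝ))
    simpa only [this] using hR2

end IsSignSystem

end SignSystem

/-! ### Norms of `L^p` and `X_{p,w}` through integrals and finite sums -/

section LpNorms

variable {𝕜 : Type*} [RCLike 𝕜] {Ω : Type*} [MeasurableSpace Ω] {μ : Measure Ω}

theorem MeasureTheory.MemLp.norm_toLp_rpow {p : ℝ≥0∞} (hp : 0 < p.toReal) {f : Ω → 𝕜}
    (hf : MemLp f p μ) : ‖hf.toLp f‖ ^ p.toReal = ∫ t, ‖f t‖ ^ p.toReal ∂μ := by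
  have h := ENNReal.toReal_pos_iff.1 hp
  rw [Lp.norm_toLp, hf.eLpNorm_eq_integral_rpow_norm h.1.ne' h.2.ne,
    ENNReal.toReal_ofReal (by positivity), Real.rpow_inv_rpow
      (integral_nonneg fun t => by positivity) hp.ne']

theorem MeasureTheory.Lp.norm_rpow_toReal {p : ℝ≥0∞} (hp : 0 < p.toReal) (g : Lp 𝕜 p μ) :
    ‖g‖ ^ p.toReal = ∫ t, ‖g t‖ ^ p.toReal ∂μ := by
  have := (Lp.memLp g).norm_toLp_rpow hp
  rwa [Lp.toLp_coeFn] at this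

theorem MeasureTheory.Lp.integrable_of_fact [IsFiniteMeasure μ] {p : ℝ≥0∞} [hp : Fact (1 ≤ p)]
    (g : Lp 𝕜 p μ) : Integrable g μ :=
  (Lp.memLp g).integrable hp.out

end LpNorms

namespace Xpw

variable {𝕜 : Type*} [RCLike 𝕜] {p : ℝ≥0∞} {w : ℕ → ℝ}

theorem mem_xpwSubmodule_of_sum_le {A B : ℝ} {x : ℕ → 𝕜}
    (h1 : ∀ F : Finset ℕ, ∑ n ∈ F, ‖x n‖ ^ p.toReal ≤ A)
    (h2 : ∀ F : Finset ℕ, ∑ n ∈ F, ‖(w n : 𝕜) * x n‖ ^ 2 ≤ B) : x ∈ xpwSubmodule 𝕜 p w := by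
  refine ⟨memℓp_gen' h1, memℓp_gen' (C := B) fun F => ?_⟩
  simp only [ENNReal.toReal_ofNat, Real.rpow_two]
  exact h2 F

variable [hp : Fact (1 ≤ p)]

theorem norm_toLp_le (x : Xpw 𝕜 p w) : ‖x.toLp‖ ≤ ‖x‖ := le_max_left _ _

theorem norm_toL2_le (x : Xpw 𝕜 p w) : ‖x.toL2‖ ≤ ‖x‖ := le_max_right _ _

/-- The coordinate functionals. -/
def coord (n : ℕ) : Xpw 𝕜 p w →L[𝕜] 𝕜 :=
  LinearMap.mkContinuous { toFun := fun x => x.1 n, map_add' := fun _ _ => rfl,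
                           map_smul' := fun _ _ => rfl } 1 fun x => by
    rw [one_mul]
    exact (lp.norm_apply_le_norm (zero_lt_one.trans_le hp.out).ne' x.toLp n).trans
      x.norm_toLp_le

theorem ext_coord {x y : Xpw 𝕜 p w} (h : ∀ n, coord n x = coord n y) : x = y :=
  Subtype.ext (funext h)

theorem sum_norm_coord_rpow_le (hp0 : 0 < p.toReal) (x : Xpw 𝕜 p w) (F : Finset ℕ) :
    ∑ n ∈ F, ‖coord n x‖ ^ p.toReal ≤ ‖x‖ ^ p.toReal :=
  (lp.sum_rpow_le_norm_rpow hp0 x.toLp F).trans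
    (Real.rpow_le_rpow (norm_nonneg _) x.norm_toLp_le hp0.le)

theorem sum_norm_mul_coord_sq_le (x : Xpw 𝕜 p w) (F : Finset ℕ) :
    ∑ n ∈ F, ‖(w n : 𝕜) * coord n x‖ ^ 2 ≤ ‖x‖ ^ 2 := by
  have h := lp.sum_rpow_le_norm_rpow (p := 2) (by norm_num) x.toL2 F
  simp only [ENNReal.toReal_ofNat, Real.rpow_two] at h
  exact h.trans (pow_le_pow_left₀ (norm_nonneg _) x.norm_toL2_le 2)

theorem summable_norm_coord_rpow (hp0 : 0 < p.toReal) (x : Xpw 𝕜 p w) :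
    Summable fun n => ‖coord n x‖ ^ p.toReal :=
  x.2.1.summable hp0

theorem summable_norm_mul_coord_sq (x : Xpw 𝕜 p w) :
    Summable fun n => ‖(w n : 𝕜) * coord n x‖ ^ 2 := by
  have h := x.2.2.summable (by norm_num)
  simp only [ENNReal.toReal_ofNat, Real.rpow_two] at h
  exact h

theorem norm_le_of_sum_le (hp0 : 0 < p.toReal) {C : ℝ} (hC : 0 ≤ C) (x : Xpw 𝕜 p w)
    (h1 : ∀ F : Finset ℕ, ∑ n ∈ F, ‖coord n x‖ ^ p.toReal ≤ C ^ p.toReal)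
    (h2 : ∀ F : Finset ℕ, ∑ n ∈ F, ‖(w n : 𝕜) * coord n x‖ ^ 2 ≤ C ^ 2) : ‖x‖ ≤ C := by
  refine max_le (lp.norm_le_of_forall_sum_le hp0 hC h1)
    (lp.norm_le_of_forall_sum_le (by norm_num) hC fun F => ?_)
  simp only [ENNReal.toReal_ofNat, Real.rpow_two]
  exact h2 F

end Xpw

/-! ### Analysis and synthesis operators between `L^p` and `X_{p,w}` -/

section CoefficientOperators

variable {𝕜 : Type*} [RCLike 𝕜] {Ω : Type*} [MeasurableSpace Ω] {μ : Measure Ω}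
  {u : ℕ → Ω → 𝕜}

/-- The weights `‖u n‖_2 / ‖u n‖_p` of a sign system. -/
def signWeight (u : ℕ → Ω → 𝕜) (μ : Measure Ω) (p : ℝ) (n : ℕ) : ℝ :=
  signMass u μ n ^ (1 / 2 - 1 / p)

theorem IsSignSystem.signWeight_sq_mul (hu : IsSignSystem u μ) (p : ℝ) (n : ℕ) :
    signWeight u μ p n ^ 2 * (signMass u μ n ^ (1 / p)) ^ 2 = signMass u μ n := by
  have h := hu.signMass_pos n
  rw [← mul_pow, signWeight, ← Real.rpow_add h, ← Real.rpow_natCast, ← Real.rpow_mul h.le]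
  norm_num

theorem IsSignSystem.signMass_rpow_rpow (hu : IsSignSystem u μ) {p : ℝ} (hp : p ≠ 0) (n : ℕ) :
    (signMass u μ n ^ (1 / p)) ^ p = signMass u μ n := by
  rw [← Real.rpow_mul (hu.signMass_pos n).le, one_div_mul_cancel hp, Real.rpow_one]

variable [IsProbabilityMeasure μ] {p : ℝ≥0∞}

/-- The element of `L^p` defined by the `n`-th variable of a sign system. -/
def IsSignSystem.lpFun (hu : IsSignSystem u μ) (p : ℝ≥0∞) (n : ℕ) : Lp 𝕜 p μ :=
  (hu.memLp n p).toLp (u n)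

theorem IsSignSystem.coeFn_lpFun (hu : IsSignSystem u μ) (p : ℝ≥0∞) (n : ℕ) :
    (hu.lpFun p n : Ω → 𝕜) =ᵐ[μ] u n :=
  MemLp.coeFn_toLp _

/-- Both halves come from `sum_norm_signCoef_rpow_le`, at the exponents `p` and `2`; the second also
uses `‖g‖_2 ≤ ‖g‖_p` on a probability space. The factor `signMass ^ (1 / p)` is `‖u n‖_p`. -/
theorem IsSignSystem.sum_coef_bounds (hu : IsSignSystem u μ) (hp : 2 ≤ p.toReal) (g : Lp 𝕜 p μ)
    (F : Finset ℕ) :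
    ∑ n ∈ F, ‖(((signMass u μ n ^ (1 / p.toReal) : ℝ)) : 𝕜) * signCoef u μ g n‖ ^ p.toReal
        ≤ ‖g‖ ^ p.toReal ∧
    ∑ n ∈ F, ‖(signWeight u μ p.toReal n : 𝕜) *
        ((((signMass u μ n ^ (1 / p.toReal) : ℝ)) : 𝕜) * signCoef u μ g n)‖ ^ 2 ≤ ‖g‖ ^ 2 := by
  have hp0 : 0 < p.toReal := by linarith
  have hpt : p ≠ ∞ := (ENNReal.toReal_pos_iff.1 hp0).2.ne
  have hg : MemLp g (ENNReal.ofReal p.toReal) μ := by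
    rw [ENNReal.ofReal_toReal hpt]
    exact Lp.memLp g
  have hm : ∀ n, 0 ≤ signMass u μ n := fun n => (hu.signMass_pos n).le
  constructor
  · rw [Lp.norm_rpow_toReal hp0]
    refine le_trans (le_of_eq ?_) (hu.sum_norm_signCoef_rpow_le hp hg F)
    refine Finset.sum_congr rfl fun n _ => ?_
    have h0 : 0 ≤ signMass u μ n ^ (1 / p.toReal) := Real.rpow_nonneg (hm n) _
    rw [norm_mul, RCLike.norm_ofReal, abs_of_nonneg h0,
      Real.mul_rpow h0 (norm_nonneg _), hu.signMass_rpow_rpow hp0.ne', mul_comm]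
  · have hg2 : MemLp g 2 μ := (Lp.memLp g).mono_exponent (by
      rw [← ENNReal.ofReal_toReal hpt]
      simpa using ENNReal.ofReal_le_ofReal hp)
    have h2 := hu.sum_norm_signCoef_rpow_le (g := g) (p := 2) le_rfl (by simpa using hg2) F
    have h3 : ∫ t, ‖g t‖ ^ (2 : ℝ) ∂μ ≤ ‖g‖ ^ 2 := by
      have e := hg2.norm_toLp_rpow (by norm_num)
      rw [ENNReal.toReal_ofNat] at e
      rw [← e, Real.rpow_two]
      refine pow_le_pow_left₀ (norm_nonneg _) ?_ 2
      rw [Lp.norm_toLp, Lp.norm_def]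
      refine ENNReal.toReal_mono (Lp.eLpNorm_ne_top g)
        (eLpNorm_le_eLpNorm_of_exponent_le ?_ (Lp.aestronglyMeasurable g))
      rw [← ENNReal.ofReal_toReal hpt]
      simpa using ENNReal.ofReal_le_ofReal hp
    refine le_trans (le_of_eq ?_) (h2.trans h3)
    refine Finset.sum_congr rfl fun n _ => ?_
    rw [← mul_assoc, norm_mul, norm_mul, RCLike.norm_ofReal, RCLike.norm_ofReal, mul_pow, mul_pow,
      sq_abs, sq_abs, hu.signWeight_sq_mul, Real.rpow_two, mul_comm]

variable [hp1 : Fact (1 ≤ p)]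

/-- The operator assigning to `g` its (normalised) coefficients with respect to a sign system. -/
def IsSignSystem.coefOp (hu : IsSignSystem u μ) (hp : 2 ≤ p.toReal) :
    Lp 𝕜 p μ →L[𝕜] Xpw 𝕜 p (signWeight u μ p.toReal) :=
  LinearMap.mkContinuous
    { toFun := fun g => ⟨fun n => (((signMass u μ n ^ (1 / p.toReal) : ℝ)) : 𝕜) *
          signCoef u μ g n,
        Xpw.mem_xpwSubmodule_of_sum_le (fun F => (hu.sum_coef_bounds hp g F).1)
          fun F => (hu.sum_coef_bounds hp g F).2⟩
      map_add' := fun g h => Subtype.ext <| funext fun n => by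
        change _ * signCoef u μ _ n = _ * signCoef u μ _ n + _ * signCoef u μ _ n
        rw [← mul_add]
        congr 1
        rw [signCoef, signCoef, signCoef, ← mul_add]
        congr 1
        rw [← integral_add (hu.integrable_mul (Lp.integrable_of_fact g) n)
          (hu.integrable_mul (Lp.integrable_of_fact h) n)]
        refine integral_congr_ae ?_
        filter_upwards [Lp.coeFn_add g h] with t ht
        rw [ht, Pi.add_apply, add_mul]
      map_smul' := fun a g => Subtype.ext <| funext fun n => by
        change _ * signCoef u μ _ n = a * (_ * signCoef u μ _ n)
        rw [mul_left_comm a]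
        congr 1
        rw [signCoef, signCoef, mul_left_comm a]
        congr 1
        rw [← integral_const_mul]
        refine integral_congr_ae ?_
        filter_upwards [Lp.coeFn_smul a g] with t ht
        rw [ht, Pi.smul_apply, smul_eq_mul, mul_assoc] } 1 fun g => by
    rw [one_mul]
    exact Xpw.norm_le_of_sum_le (by linarith) (norm_nonneg g) _
      (fun F => (hu.sum_coef_bounds hp g F).1) fun F => (hu.sum_coef_bounds hp g F).2

theorem IsSignSystem.norm_coefOp_le (hu : IsSignSystem u μ) (hp : 2 ≤ p.toReal) :
    ‖hu.coefOp hp‖ ≤ 1 :=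
  LinearMap.mkContinuous_norm_le _ zero_le_one _

theorem IsSignSystem.coord_coefOp (hu : IsSignSystem u μ) (hp : 2 ≤ p.toReal) (g : Lp 𝕜 p μ)
    (n : ℕ) : Xpw.coord n (hu.coefOp hp g) =
      (((signMass u μ n ^ (1 / p.toReal) : ℝ)) : 𝕜) * signCoef u μ g n := rfl

/-- The normalised functions of a sign system in `L^p`. -/
def IsSignSystem.basisFun (hu : IsSignSystem u μ) (p : ℝ≥0∞) (n : ℕ) : Lp 𝕜 p μ :=
  (((signMass u μ n ^ (1 / p.toReal))⁻¹ : ℝ) : 𝕜) • hu.lpFun p n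

theorem IsSignSystem.coord_coefOp_basisFun (hu : IsSignSystem u μ) (hp : 2 ≤ p.toReal) (k n : ℕ) :
    Xpw.coord n (hu.coefOp hp (hu.basisFun p k)) = if k = n then 1 else 0 := by
  have h1 : signCoef u μ (hu.lpFun p k) n = if k = n then 1 else 0 := by
    rw [signCoef, integral_congr_ae (g := fun t => u k t * u n t) (by
      filter_upwards [hu.coeFn_lpFun p k] with t ht
      rw [ht]), hu.integral_mul_eq]
    split_ifs with h
    · rw [← RCLike.ofReal_mul, inv_mul_cancel₀ (hu.signMass_pos n).ne', RCLike.ofReal_one]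
    · rw [mul_zero]
  rw [IsSignSystem.basisFun, map_smul, map_smul, hu.coord_coefOp, h1, smul_eq_mul]
  split_ifs with h
  · subst h
    rw [mul_one, ← RCLike.ofReal_mul,
      inv_mul_cancel₀ (Real.rpow_pos_of_pos (hu.signMass_pos k) _).ne', RCLike.ofReal_one]
  · rw [mul_zero, mul_zero]

/-- Rosenthal's inequality for the coefficients `x n / ‖u n‖_p`: its two moment sums become the
`ℓ^p` sum and the weighted `ℓ^2` sum of `x`. -/
theorem IsSignSystem.norm_sum_basisFun_le (hu : IsSignSystem u μ) (hp : 2 ≤ p.toReal)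
    (x : ℕ → 𝕜) (F : Finset ℕ) {R : ℝ} (hR : 0 ≤ R)
    (h1 : ∑ n ∈ F, ‖x n‖ ^ p.toReal ≤ R ^ p.toReal)
    (h2 : ∑ n ∈ F, ‖(signWeight u μ p.toReal n : 𝕜) * x n‖ ^ 2 ≤ R ^ 2) :
    ‖∑ n ∈ F, x n • hu.basisFun p n‖ ≤ rosenthalConst p.toReal ^ (1 / p.toReal) * R := by
  have hp0 : 0 < p.toReal := by linarith
  have hK := rosenthalConst_pos hp0.le
  set b : ℕ → 𝕜 := fun n => x n * (((signMass u μ n ^ (1 / p.toReal))⁻¹ : ℝ) : 𝕜) with hb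
  have hbn : ∀ n, ‖b n‖ = ‖x n‖ * (signMass u μ n ^ (1 / p.toReal))⁻¹ := fun n => by
    rw [hb, norm_mul, RCLike.norm_ofReal, abs_of_nonneg]
    exact inv_nonneg.2 (Real.rpow_nonneg (hu.signMass_pos n).le _)
  have hae : ((∑ n ∈ F, x n • hu.basisFun p n : Lp 𝕜 p μ) : Ω → 𝕜)
      =ᵐ[μ] fun t => ∑ n ∈ F, b n * u n t := by
    have hall : ∀ᵐ t ∂μ, ∀ n, (x n • hu.basisFun p n : Lp 𝕜 p μ) t = b n * u n t := by
      refine ae_all_iff.2 fun n => ?_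
      rw [IsSignSystem.basisFun, smul_smul]
      filter_upwards [Lp.coeFn_smul (b n) (hu.lpFun p n), hu.coeFn_lpFun p n] with t h3 h4
      rw [h3, Pi.smul_apply, h4, smul_eq_mul]
    filter_upwards [Lp.coeFn_finsetSum F fun n => x n • hu.basisFun p n, hall] with t h3 h4
    rw [h3, Finset.sum_apply]
    exact Finset.sum_congr rfl fun n _ => h4 n
  have hint := hu.integral_norm_sum_rpow_le hp b F hR (by
      refine le_trans (le_of_eq (Finset.sum_congr rfl fun n _ => ?_)) h1
      have h0 : 0 < signMass u μ n ^ (1 / p.toReal) := Real.rpow_pos_of_pos (hu.signMass_pos n) _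
      rw [hbn, Real.mul_rpow (norm_nonneg _) (inv_nonneg.2 h0.le), Real.inv_rpow h0.le,
        hu.signMass_rpow_rpow hp0.ne', mul_assoc, inv_mul_cancel₀ (hu.signMass_pos n).ne',
        mul_one]) (by
      refine le_trans (le_of_eq (Finset.sum_congr rfl fun n _ => ?_)) h2
      have h0 : 0 < signMass u μ n ^ (1 / p.toReal) := Real.rpow_pos_of_pos (hu.signMass_pos n) _
      rw [← hu.signWeight_sq_mul p.toReal n]
      rw [hbn, norm_mul, RCLike.norm_ofReal, mul_pow _ ‖x n‖, sq_abs]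
      field_simp)
  have h5 : ‖∑ n ∈ F, x n • hu.basisFun p n‖ ^ p.toReal ≤
      (rosenthalConst p.toReal ^ (1 / p.toReal) * R) ^ p.toReal := by
    rw [Lp.norm_rpow_toReal hp0, Real.mul_rpow (by positivity) hR, ← Real.rpow_mul hK.le,
      one_div_mul_cancel hp0.ne', Real.rpow_one]
    refine le_trans (le_of_eq (integral_congr_ae ?_)) hint
    filter_upwards [hae] with t ht
    rw [ht]
  exact (Real.rpow_le_rpow_iff (norm_nonneg _) (by positivity) hp0).1 h5

theorem IsSignSystem.summable_basisFun (hu : IsSignSystem u μ) (hp : 2 ≤ p.toReal)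
    (x : Xpw 𝕜 p (signWeight u μ p.toReal)) :
    Summable fun n => Xpw.coord n x • hu.basisFun p n := by
  have hp0 : 0 < p.toReal := by linarith
  have hK := rosenthalConst_pos hp0.le
  set K := rosenthalConst p.toReal ^ (1 / p.toReal) with hKdef
  have hK0 : 0 < K := Real.rpow_pos_of_pos hK _
  refine summable_iff_vanishing_norm.2 fun ε hε => ?_
  set R := ε / (2 * K) with hRdef
  have hR : 0 < R := by positivity
  obtain ⟨s1, hs1⟩ := summable_iff_vanishing_norm.1 (x.summable_norm_coord_rpow hp0)
    (R ^ p.toReal) (by positivity)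
  obtain ⟨s2, hs2⟩ := summable_iff_vanishing_norm.1 x.summable_norm_mul_coord_sq
    (R ^ 2) (by positivity)
  refine ⟨s1 ∪ s2, fun t ht => ?_⟩
  rw [Finset.disjoint_union_right] at ht
  have h1 := (le_abs_self _).trans (hs1 t ht.1).le
  have h2 := (le_abs_self _).trans (hs2 t ht.2).le
  refine (hu.norm_sum_basisFun_le hp _ t hR.le h1 h2).trans_lt ?_
  rw [← hKdef, hRdef]
  have : K * (ε / (2 * K)) = ε / 2 := by field_simp
  linarith

/-- The operator assigning to `x` the sum `∑ x n • e n` over the normalised functions `e n` of a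
sign system. -/
def IsSignSystem.synthOp (hu : IsSignSystem u μ) (hp : 2 ≤ p.toReal) :
    Xpw 𝕜 p (signWeight u μ p.toReal) →L[𝕜] Lp 𝕜 p μ :=
  LinearMap.mkContinuous
    { toFun := fun x => ∑' n, Xpw.coord n x • hu.basisFun p n
      map_add' := fun x y => by
        rw [← (hu.summable_basisFun hp x).tsum_add (hu.summable_basisFun hp y)]
        simp only [map_add, add_smul]
      map_smul' := fun a x => by
        simp only [map_smul, smul_eq_mul, mul_smul, RingHom.id_apply]
        exact (hu.summable_basisFun hp x).tsum_const_smul a }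
    (rosenthalConst p.toReal ^ (1 / p.toReal)) fun x =>
      le_of_tendsto (hu.summable_basisFun hp x).hasSum.norm <| Filter.Eventually.of_forall fun F =>
        hu.norm_sum_basisFun_le hp _ F (norm_nonneg x)
          (x.sum_norm_coord_rpow_le (by linarith) F) (x.sum_norm_mul_coord_sq_le F)

theorem IsSignSystem.hasSum_synthOp (hu : IsSignSystem u μ) (hp : 2 ≤ p.toReal)
    (x : Xpw 𝕜 p (signWeight u μ p.toReal)) :
    HasSum (fun n => Xpw.coord n x • hu.basisFun p n) (hu.synthOp hp x) :=
  (hu.summable_basisFun hp x).hasSum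

theorem IsSignSystem.norm_synthOp_le (hu : IsSignSystem u μ) (hp : 2 ≤ p.toReal) :
    ‖hu.synthOp hp‖ ≤ rosenthalConst p.toReal ^ (1 / p.toReal) :=
  LinearMap.mkContinuous_norm_le _
    (Real.rpow_nonneg (rosenthalConst_pos (by linarith)).le _) _

/-- Coordinates are continuous, so they can be taken term by term in the series, where
biorthogonality leaves a single term. -/
theorem IsSignSystem.coefOp_synthOp (hu : IsSignSystem u μ) (hp : 2 ≤ p.toReal)
    (x : Xpw 𝕜 p (signWeight u μ p.toReal)) : hu.coefOp hp (hu.synthOp hp x) = x := by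
  refine Xpw.ext_coord fun n => ?_
  have h := (hu.hasSum_synthOp hp x).mapL ((Xpw.coord n).comp (hu.coefOp hp))
  simp only [map_smul, ContinuousLinearMap.comp_apply, hu.coord_coefOp_basisFun, smul_eq_mul,
    mul_ite, mul_one, mul_zero] at h
  have h2 := hasSum_single (f := fun k => if k = n then Xpw.coord k x else 0) n
    fun b hb => if_neg hb
  simp only [if_true] at h2
  exact h.unique h2

end CoefficientOperators

/-! ### Inclusions between `L^s` and `L^r` -/

section LpInclusion

variable {𝕜 : Type*} [RCLike 𝕜] {Ω : Type*} [MeasurableSpace Ω] {μ : Measure Ω}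
  [IsProbabilityMeasure μ] {r s : ℝ≥0∞} [Fact (1 ≤ r)] [Fact (1 ≤ s)]

/-- The inclusion of `L^s` in `L^r` over a probability space, `r ≤ s`. -/
def lpInclusion (𝕜 : Type*) [RCLike 𝕜] (μ : Measure Ω) [IsProbabilityMeasure μ] (h : r ≤ s) :
    Lp 𝕜 s μ →L[𝕜] Lp 𝕜 r μ :=
  LinearMap.mkContinuous
    { toFun := fun g => ((Lp.memLp g).mono_exponent h).toLp g
      map_add' := fun f g => by
        rw [← MemLp.toLp_add]
        exact (MemLp.toLp_eq_toLp_iff _ _).2 (Lp.coeFn_add f g)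
      map_smul' := fun c g => by
        rw [RingHom.id_apply, ← MemLp.toLp_const_smul]
        exact (MemLp.toLp_eq_toLp_iff _ _).2 (Lp.coeFn_smul c g) } 1 fun g => by
    rw [one_mul]
    change ‖MemLp.toLp _ ((Lp.memLp g).mono_exponent h)‖ ≤ _
    rw [Lp.norm_toLp, Lp.norm_def]
    exact ENNReal.toReal_mono (Lp.eLpNorm_ne_top g)
      (eLpNorm_le_eLpNorm_of_exponent_le h (Lp.aestronglyMeasurable g))

theorem coeFn_lpInclusion (h : r ≤ s) (g : Lp 𝕜 s μ) : (lpInclusion 𝕜 μ h g : Ω → 𝕜) =ᵐ[μ] g :=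
  MemLp.coeFn_toLp ((Lp.memLp g).mono_exponent h)

theorem lpInclusion_eq_iff (h : r ≤ s) (g : Lp 𝕜 s μ) (k : Lp 𝕜 r μ) :
    lpInclusion 𝕜 μ h g = k ↔ (g : Ω → 𝕜) =ᵐ[μ] k := by
  refine ⟨fun e => e ▸ (coeFn_lpInclusion h g).symm, fun e => Lp.ext ?_⟩
  exact (coeFn_lpInclusion h g).trans e

theorem denseRange_lpInclusion (h : r ≤ s) (hr : r ≠ ∞) :
    DenseRange (lpInclusion 𝕜 μ h : Lp 𝕜 s μ → Lp 𝕜 r μ) := by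
  refine (Lp.simpleFunc.dense (E := 𝕜) (μ := μ) hr).mono fun g hg => ?_
  have hs := (Lp.simpleFunc.toSimpleFunc ⟨g, hg⟩).memLp_of_isFiniteMeasure s μ
  refine ⟨hs.toLp _, (lpInclusion_eq_iff h _ _).2 ?_⟩
  exact (MemLp.coeFn_toLp hs).trans (Lp.simpleFunc.toSimpleFunc_eq_toFun ⟨g, hg⟩)

end LpInclusion

/-! ### Projections agreeing with the orthogonal projection -/

section OrthogonalProjection

variable {𝕜 : Type*} [RCLike 𝕜] {Ω : Type*} [MeasurableSpace Ω] {μ : Measure Ω}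
  [IsProbabilityMeasure μ] {u : ℕ → Ω → 𝕜}

namespace IsSignSystem

/-- The closed linear span of a sign system in `L^r`. -/
def lpSpan (hu : IsSignSystem u μ) (r : ℝ≥0∞) [Fact (1 ≤ r)] : Submodule 𝕜 (Lp 𝕜 r μ) :=
  (Submodule.span 𝕜 (Set.range (hu.lpFun r))).topologicalClosure

instance (hu : IsSignSystem u μ) (r : ℝ≥0∞) [Fact (1 ≤ r)] : CompleteSpace (hu.lpSpan r) :=
  (Submodule.isClosed_topologicalClosure _).completeSpace_coe

theorem isClosed_lpSpan (hu : IsSignSystem u μ) (r : ℝ≥0∞) [Fact (1 ≤ r)] :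
    IsClosed (hu.lpSpan r : Set (Lp 𝕜 r μ)) :=
  Submodule.isClosed_topologicalClosure _

theorem lpFun_mem_lpSpan (hu : IsSignSystem u μ) (r : ℝ≥0∞) [Fact (1 ≤ r)] (n : ℕ) :
    hu.lpFun r n ∈ hu.lpSpan r :=
  Submodule.le_topologicalClosure _ (Submodule.subset_span ⟨n, rfl⟩)

theorem lpSpan_le (hu : IsSignSystem u μ) {r : ℝ≥0∞} [Fact (1 ≤ r)] {K : Submodule 𝕜 (Lp 𝕜 r μ)}
    (hK : IsClosed (K : Set (Lp 𝕜 r μ))) (h : ∀ n, hu.lpFun r n ∈ K) : hu.lpSpan r ≤ K :=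
  Submodule.topologicalClosure_minimal _
    (Submodule.span_le.2 (by rintro _ ⟨n, rfl⟩; exact h n)) hK

variable {r s : ℝ≥0∞} [Fact (1 ≤ r)] [Fact (1 ≤ s)]

theorem lpInclusion_lpFun (hu : IsSignSystem u μ) (h : r ≤ s) (n : ℕ) :
    lpInclusion 𝕜 μ h (hu.lpFun s n) = hu.lpFun r n :=
  (lpInclusion_eq_iff h _ _).2 ((hu.coeFn_lpFun s n).trans (hu.coeFn_lpFun r n).symm)

theorem lpInclusion_mem_lpSpan (hu : IsSignSystem u μ) (h : r ≤ s) {g : Lp 𝕜 s μ}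
    (hg : g ∈ hu.lpSpan s) : lpInclusion 𝕜 μ h g ∈ hu.lpSpan r := by
  have : hu.lpSpan s ≤ (hu.lpSpan r).comap (lpInclusion 𝕜 μ h).toLinearMap :=
    hu.lpSpan_le ((hu.isClosed_lpSpan r).preimage (lpInclusion 𝕜 μ h).continuous) fun n => by
      rw [Submodule.mem_comap]
      change lpInclusion 𝕜 μ h _ ∈ _
      rw [hu.lpInclusion_lpFun]
      exact hu.lpFun_mem_lpSpan r n
  exact this hg

/-- A bounded projection of `L^p` onto the closed span of a sign system, with norm at most `C`,
which agrees with the orthogonal projection of `L^2`. -/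
def IsOrthoProjection (hu : IsSignSystem u μ) (p : ℝ≥0∞) [Fact (1 ≤ p)] (C : ℝ)
    (P : Lp 𝕜 p μ →L[𝕜] Lp 𝕜 p μ) : Prop :=
  P ∘L P = P ∧ P.range = hu.lpSpan p ∧ ‖P‖ ≤ C ∧
    ∀ (g : Lp 𝕜 p μ) (h : Lp 𝕜 2 μ), (g : Ω → 𝕜) =ᵐ[μ] h →
      (P g : Ω → 𝕜) =ᵐ[μ] (hu.lpSpan 2).starProjection h

theorem isOrthoProjection_two (hu : IsSignSystem u μ) :
    hu.IsOrthoProjection 2 1 (hu.lpSpan 2).starProjection := by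
  refine ⟨?_, ?_, Submodule.starProjection_norm_le _, fun g h e => ?_⟩
  · ext1 g
    exact Submodule.starProjection_eq_self_iff.2 (Submodule.starProjection_apply_mem _ _)
  · exact Submodule.range_starProjection _
  · rw [Lp.ext e]

theorem inner_lpFun (hu : IsSignSystem u μ) (n : ℕ) (v : Lp 𝕜 2 μ) :
    inner 𝕜 (hu.lpFun 2 n) v = ∫ t, v t * u n t ∂μ := by
  rw [L2.inner_def]
  refine integral_congr_ae ?_
  filter_upwards [hu.coeFn_lpFun 2 n, hu.star_eq n] with t h1 h2
  rw [h1, RCLike.inner_apply, h2]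

/-- The constant bounding the projections for exponents above `2`. -/
def projConst (p : ℝ) : ℝ := rosenthalConst p ^ (1 / p)

variable {p : ℝ≥0∞} [hp1 : Fact (1 ≤ p)]

theorem basisFun_mem_lpSpan (hu : IsSignSystem u μ) (n : ℕ) :
    hu.basisFun p n ∈ hu.lpSpan p :=
  Submodule.smul_mem _ _ (hu.lpFun_mem_lpSpan p n)

theorem synthOp_mem_lpSpan (hu : IsSignSystem u μ) (hp : 2 ≤ p.toReal)
    (x : Xpw 𝕜 p (signWeight u μ p.toReal)) : hu.synthOp hp x ∈ hu.lpSpan p :=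
  (hu.isClosed_lpSpan p).mem_of_tendsto (hu.hasSum_synthOp hp x) <|
    Filter.Eventually.of_forall fun _ =>
      Submodule.sum_mem _ fun n _ => Submodule.smul_mem _ _ (hu.basisFun_mem_lpSpan n)

/-- The residual `d` has `coefOp d = 0`, because `coefOp` is a left inverse of `synthOp`. Hence `∫ d
* u n = 0` for all `n`, and `d` is orthogonal to the closed span, which characterises the orthogonal
projection. -/
theorem lpInclusion_synthOp_coefOp (hu : IsSignSystem u μ) (hp : 2 ≤ p.toReal) (hp2 : 2 ≤ p)
    (g : Lp 𝕜 p μ) : lpInclusion 𝕜 μ hp2 (hu.synthOp hp (hu.coefOp hp g)) =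
      (hu.lpSpan 2).starProjection (lpInclusion 𝕜 μ hp2 g) := by
  symm
  refine Submodule.eq_starProjection_of_mem_of_inner_eq_zero
    (hu.lpInclusion_mem_lpSpan hp2 (hu.synthOp_mem_lpSpan hp _)) fun k hk => ?_
  rw [← map_sub]
  set d := g - hu.synthOp hp (hu.coefOp hp g) with hd
  have hcoef : hu.coefOp hp d = 0 := by
    rw [hd, map_sub, hu.coefOp_synthOp, sub_self]
  have hle : hu.lpSpan 2 ≤ (Submodule.span 𝕜 {lpInclusion 𝕜 μ hp2 d})ᗮ := by
    refine hu.lpSpan_le (Submodule.isClosed_orthogonal _) fun n => ?_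
    rw [Submodule.mem_orthogonal_singleton_iff_inner_left, hu.inner_lpFun,
      integral_congr_ae (g := fun t => d t * u n t) (by
        filter_upwards [coeFn_lpInclusion hp2 d] with t ht
        rw [ht]), ← hu.signMass_mul_signCoef]
    have h1 := hu.coord_coefOp hp d n
    rw [hcoef, map_zero] at h1
    rcases mul_eq_zero.1 h1.symm with h2 | h2
    · exact absurd (RCLike.ofReal_eq_zero.1 h2) (Real.rpow_pos_of_pos (hu.signMass_pos n) _).ne'
    · rw [h2, mul_zero]
  exact Submodule.mem_orthogonal_singleton_iff_inner_right.1 (hle hk)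

theorem isOrthoProjection_of_two_le (hu : IsSignSystem u μ) (hp : 2 ≤ p.toReal) (hp2 : 2 ≤ p) :
    hu.IsOrthoProjection p (projConst p.toReal) (hu.synthOp hp ∘L hu.coefOp hp) := by
  have key := hu.lpInclusion_synthOp_coefOp hp hp2
  have inj : ∀ g h : Lp 𝕜 p μ, lpInclusion 𝕜 μ hp2 g = lpInclusion 𝕜 μ hp2 h → g = h :=
    fun g h e => Lp.ext (((lpInclusion_eq_iff hp2 _ _).1 e).trans (coeFn_lpInclusion hp2 h))
  refine ⟨?_, le_antisymm ?_ ?_, ?_, fun g h e => ?_⟩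
  · ext1 g
    simp only [ContinuousLinearMap.comp_apply, hu.coefOp_synthOp]
  · rintro _ ⟨g, rfl⟩
    exact hu.synthOp_mem_lpSpan hp _
  -- An element of the `L^p` span lies in the `L^2` span, is fixed by the orthogonal projection, and
  -- hence by the operator, as `L^p` embeds injectively in `L^2`.
  · intro g hg
    refine ⟨g, inj _ _ ((key g).trans ?_)⟩
    exact Submodule.starProjection_eq_self_iff.2 (hu.lpInclusion_mem_lpSpan hp2 hg)
  · refine (ContinuousLinearMap.opNorm_comp_le _ _).trans ?_
    have h1 := hu.norm_synthOp_le hp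
    have h2 := hu.norm_coefOp_le hp
    calc _ ≤ projConst p.toReal * 1 :=
          mul_le_mul h1 h2 (norm_nonneg _) ((norm_nonneg _).trans h1)
      _ = _ := mul_one _
  · rw [← (lpInclusion_eq_iff hp2 g h).2 e, ← key]
    exact (coeFn_lpInclusion hp2 _).symm

/-- With `k` the projection of `h`, pair `k` with its norming function `y`. Self-adjointness moves
the projection onto `y`, which lies in `L^q`, where the projection is `Q` and has norm at most `C`.
-/
theorem norm_starProjection_le_of_dual (hu : IsSignSystem u μ) {q : ℝ≥0∞} [Fact (1 ≤ q)]
    (hpq : p.toReal.HolderConjugate q.toReal) (hp2 : p ≤ 2) {C : ℝ} {Q : Lp 𝕜 q μ →L[𝕜] Lp 𝕜 q μ}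
    (hQ : hu.IsOrthoProjection q C Q) (h : Lp 𝕜 2 μ) :
    ‖lpInclusion 𝕜 μ hp2 ((hu.lpSpan 2).starProjection h)‖ ≤ C * ‖lpInclusion 𝕜 μ hp2 h‖ := by
  set k := (hu.lpSpan 2).starProjection h with hk
  have hp0 := hpq.pos
  have hq0 := hpq.symm.pos
  have hpt : p ≠ ∞ := (ENNReal.toReal_pos_iff.1 hp0).2.ne
  have hqt : q ≠ ∞ := (ENNReal.toReal_pos_iff.1 hq0).2.ne
  have hC : 0 ≤ C := (norm_nonneg _).trans hQ.2.2.1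
  have hpR2 : p.toReal ≤ 2 := by simpa using ENNReal.toReal_mono (by simp) hp2
  have hkp : MemLp k p μ := (Lp.memLp k).mono_exponent hp2
  -- The exponent `p - 2` may be negative; where `k` vanishes the factor `k t` makes `y` zero, so
  -- these points are treated apart below.
  set y : Ω → 𝕜 := fun t => ((‖k t‖ ^ (p.toReal - 2) : ℝ) : 𝕜) * k t with hy
  have hyn : ∀ t, ‖y t‖ = ‖k t‖ ^ (p.toReal - 1) := fun t => by
    rw [hy, norm_mul, RCLike.norm_ofReal, abs_of_nonneg (by positivity)]
    rcases eq_or_ne (k t) 0 with h0 | h0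
    · simp [h0, Real.zero_rpow hpq.sub_one_ne_zero]
    · rw [← Real.rpow_add_one (norm_ne_zero_iff.2 h0)]
      congr 1
      ring
  have hym : AEStronglyMeasurable y μ := by
    have h1 : AEMeasurable k μ := (Lp.aestronglyMeasurable k).aemeasurable
    exact (AEMeasurable.mul (RCLike.measurable_ofReal.comp_aemeasurable
      (h1.norm.pow_const _)) h1).aestronglyMeasurable
  have hyq_eq : ∀ t, ‖y t‖ ^ q.toReal = ‖k t‖ ^ p.toReal := fun t => by
    rw [hyn, ← Real.rpow_mul (norm_nonneg _), hpq.sub_one_mul_conj]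
  have hyq : MemLp y q μ := by
    refine (integrable_norm_rpow_iff hym (ENNReal.toReal_pos_iff.1 hq0).1.ne' hqt).1 ?_
    simp only [hyq_eq]
    exact hkp.integrable_norm_rpow'
  have hq2 : 2 ≤ q := by
    have h1 := hpq.symm.sub_one_mul_conj
    have h2 : 2 ≤ q.toReal := by nlinarith [hpq.symm.sub_one_pos]
    rw [← ENNReal.ofReal_toReal hqt]
    simpa using ENNReal.ofReal_le_ofReal h2
  have hy2 : MemLp y 2 μ := hyq.mono_exponent hq2
  set S := ∫ t, ‖k t‖ ^ p.toReal ∂μ with hS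
  have hS0 : 0 ≤ S := integral_nonneg fun t => by positivity
  have e1 : inner 𝕜 (hy2.toLp y) k = ((S : ℝ) : 𝕜) := by
    rw [L2.inner_def, hS, ← integral_ofReal]
    refine integral_congr_ae ?_
    filter_upwards [hy2.coeFn_toLp] with t ht
    rw [ht, RCLike.inner_apply, hy, map_mul, RCLike.conj_ofReal, mul_left_comm, RCLike.mul_conj,
      ← RCLike.ofReal_pow, ← RCLike.ofReal_mul]
    rcases eq_or_ne (k t) 0 with h0 | h0
    · simp [h0, Real.zero_rpow hp0.ne']
    · rw [← Real.rpow_add_natCast (norm_ne_zero_iff.2 h0)]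
      norm_num
  have e2 : inner 𝕜 (hy2.toLp y) k = ∫ t, inner 𝕜 (Q (hyq.toLp y) t) (h t) ∂μ := by
    refine (Submodule.starProjection_isSymmetric (hu.lpSpan 2) (hy2.toLp y) h).symm.trans ?_
    change inner 𝕜 ((hu.lpSpan 2).starProjection (hy2.toLp y)) h = _
    rw [L2.inner_def]
    refine integral_congr_ae ?_
    filter_upwards [hQ.2.2.2 (hyq.toLp y) (hy2.toLp y)
      (hyq.coeFn_toLp.trans hy2.coeFn_toLp.symm)] with t ht
    rw [ht]
  have hhp : MemLp h (ENNReal.ofReal p.toReal) μ := by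
    rw [ENNReal.ofReal_toReal hpt]
    exact (Lp.memLp h).mono_exponent hp2
  have hzq : MemLp (Q (hyq.toLp y)) (ENNReal.ofReal q.toReal) μ := by
    rw [ENNReal.ofReal_toReal hqt]
    exact Lp.memLp _
  set N := lpInclusion 𝕜 μ hp2 h with hN
  have hNn : (∫ t, ‖h t‖ ^ p.toReal ∂μ) ^ (1 / p.toReal) = ‖N‖ := by
    have := Lp.norm_rpow_toReal hp0 N
    rw [integral_congr_ae (g := fun t => ‖h t‖ ^ p.toReal) (by
      filter_upwards [coeFn_lpInclusion hp2 h] with t ht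
      rw [ht])] at this
    rw [← this, ← Real.rpow_mul (norm_nonneg _), mul_one_div_cancel hp0.ne', Real.rpow_one]
  have hzn : (∫ t, ‖Q (hyq.toLp y) t‖ ^ q.toReal ∂μ) ^ (1 / q.toReal) ≤
      C * S ^ (1 / q.toReal) := by
    rw [← Lp.norm_rpow_toReal hq0, ← Real.rpow_mul (norm_nonneg _), mul_one_div_cancel hq0.ne',
      Real.rpow_one]
    refine ((Q.le_opNorm _).trans (mul_le_mul_of_nonneg_right hQ.2.2.1 (norm_nonneg _))).trans
      (le_of_eq ?_)
    have := hyq.norm_toLp_rpow hq0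
    simp only [hyq_eq] at this
    rw [hS, ← this, ← Real.rpow_mul (norm_nonneg _), mul_one_div_cancel hq0.ne', Real.rpow_one]
  have e3 : S ≤ C * S ^ (1 / q.toReal) * ‖N‖ := by
    calc S = ‖∫ t, inner 𝕜 (Q (hyq.toLp y) t) (h t) ∂μ‖ := by
          rw [← e2, e1, RCLike.norm_ofReal, abs_of_nonneg hS0]
      _ ≤ ∫ t, ‖inner 𝕜 (Q (hyq.toLp y) t) (h t)‖ ∂μ := norm_integral_le_integral_norm _
      _ = ∫ t, ‖Q (hyq.toLp y) t‖ * ‖h t‖ ∂μ := by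
          simp only [RCLike.inner_apply, norm_mul, RCLike.norm_conj, mul_comm]
      _ ≤ _ := integral_mul_norm_le_Lp_mul_Lq hpq.symm hzq hhp
      _ ≤ _ := by
          rw [hNn]
          exact mul_le_mul_of_nonneg_right hzn (norm_nonneg _)
  have hkn : ‖lpInclusion 𝕜 μ hp2 k‖ = S ^ (1 / p.toReal) := by
    have := Lp.norm_rpow_toReal hp0 (lpInclusion 𝕜 μ hp2 k)
    rw [integral_congr_ae (g := fun t => ‖k t‖ ^ p.toReal) (by
      filter_upwards [coeFn_lpInclusion hp2 k] with t ht
      rw [ht]), ← hS] at this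
    rw [← this, ← Real.rpow_mul (norm_nonneg _), mul_one_div_cancel hp0.ne', Real.rpow_one]
  rw [hkn]
  rcases hS0.eq_or_lt with h0 | h0
  · rw [← h0, Real.zero_rpow (by positivity)]
    positivity
  · have e4 : S = S ^ (1 / p.toReal) * S ^ (1 / q.toReal) := by
      rw [← Real.rpow_add h0, one_div, one_div, hpq.inv_add_inv_eq_one, Real.rpow_one]
    nth_rewrite 1 [e4] at e3
    rw [mul_right_comm] at e3
    exact le_of_mul_le_mul_right e3 (by positivity)

/-- `L^2` is dense in `L^p` and the orthogonal projection is bounded there for the `L^p` norm, so it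
extends. Idempotence and the inclusion of the range in the span pass to the limit; conversely the
extension fixes each `u n`, hence the closed span. -/
theorem exists_isOrthoProjection_of_dual (hu : IsSignSystem u μ) {q : ℝ≥0∞} [Fact (1 ≤ q)]
    (hpq : p.toReal.HolderConjugate q.toReal) (hp2 : p ≤ 2) {C : ℝ} {Q : Lp 𝕜 q μ →L[𝕜] Lp 𝕜 q μ}
    (hQ : hu.IsOrthoProjection q C Q) : ∃ P, hu.IsOrthoProjection p C P := by
  have hpt : p ≠ ∞ := (ENNReal.toReal_pos_iff.1 hpq.pos).2.ne
  have hC : 0 ≤ C := (norm_nonneg _).trans hQ.2.2.1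
  set ι := lpInclusion 𝕜 μ hp2 with hι
  set P₂ := (hu.lpSpan 2).starProjection with hP₂
  have hd : DenseRange (ι : Lp 𝕜 2 μ → Lp 𝕜 p μ) := denseRange_lpInclusion hp2 hpt
  have hb := hu.norm_starProjection_le_of_dual hpq hp2 hQ
  set P : Lp 𝕜 p μ →L[𝕜] Lp 𝕜 p μ :=
    LinearMap.extendOfNorm (ι ∘L P₂).toLinearMap ι.toLinearMap with hP
  have hPι : ∀ h, P (ι h) = ι (P₂ h) := fun h =>
    LinearMap.extendOfNorm_eq (f := (ι ∘L P₂).toLinearMap) (e := ι.toLinearMap) hd ⟨C, hb⟩ h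
  have hPP : ∀ g, P (P g) = P g := fun g => by
    refine hd.induction_on (p := fun g => P (P g) = P g) g
      (isClosed_eq (by fun_prop) (by fun_prop)) fun h => ?_
    rw [hPι, hPι, Submodule.starProjection_eq_self_iff.2 (Submodule.starProjection_apply_mem _ _)]
  refine ⟨P, ContinuousLinearMap.ext hPP, le_antisymm ?_ ?_, ?_, fun g h e => ?_⟩
  · rintro _ ⟨g, rfl⟩
    refine hd.induction_on (p := fun g => P g ∈ hu.lpSpan p) g
      ((hu.isClosed_lpSpan p).preimage P.continuous) fun h => ?_
    rw [hPι]
    exact hu.lpInclusion_mem_lpSpan hp2 (Submodule.starProjection_apply_mem _ _)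
  · have hfix : hu.lpSpan p ≤ LinearMap.eqLocus P.toLinearMap LinearMap.id := by
      refine hu.lpSpan_le (isClosed_eq P.continuous continuous_id) fun n => ?_
      rw [LinearMap.mem_eqLocus]
      change P _ = _
      rw [← hu.lpInclusion_lpFun hp2, hPι,
        Submodule.starProjection_eq_self_iff.2 (hu.lpFun_mem_lpSpan 2 n)]
      rfl
    exact fun g hg => ⟨g, hfix hg⟩
  · exact LinearMap.opNorm_extendOfNorm_le hd hC hb
  · have : g = ι h := ((lpInclusion_eq_iff hp2 h g).2 e.symm).symm
    rw [this, hPι]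
    exact coeFn_lpInclusion hp2 _

end IsSignSystem

end OrthogonalProjection

/-! ### From symmetric three-valued variables to sign systems -/

section ThreeValued

variable {𝕜 : Type*} [RCLike 𝕜] {Ω : Type*} [MeasurableSpace Ω] {μ : Measure Ω}

theorem map_eq_of_ae_mem_signs {X : Ω → 𝕜} (hX : Measurable X)
    (h : ∀ᵐ t ∂μ, X t = 1 ∨ X t = 0 ∨ X t = -1) :
    μ.map X = μ {t | X t = 1} • Measure.dirac (1 : 𝕜) + (μ {t | X t = 0} • Measure.dirac (0 : 𝕜)
      + μ {t | X t = -1} • Measure.dirac (-1 : 𝕜)) := by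
  have h1 : (1 : 𝕜) ≠ -1 := fun e => by
    have := self_eq_neg.1 e
    exact one_ne_zero this
  have hmem : ∀ᵐ z ∂(μ.map X), z ∈ ({1} ∪ ({0} ∪ {-1}) : Set 𝕜) := by
    refine (ae_map_iff hX.aemeasurable (by measurability)).2 ?_
    filter_upwards [h] with t ht
    rcases ht with e | e | e <;> simp [e]
  have hs : ∀ a : 𝕜, (μ.map X).restrict {a} = μ {t | X t = a} • Measure.dirac a := fun a => by
    rw [Measure.restrict_singleton, Measure.map_apply hX (measurableSet_singleton a)]
    rfl
  rw [← Measure.restrict_eq_self_of_ae_mem hmem,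
    Measure.restrict_union (by simp [h1]) (by measurability),
    Measure.restrict_union (by simp) (by measurability), hs, hs, hs]

theorem isSymmetricRV_of_measure_eq {X : Ω → 𝕜} (hX : Measurable X)
    (h : ∀ᵐ t ∂μ, X t = 1 ∨ X t = 0 ∨ X t = -1) (he : μ {t | X t = 1} = μ {t | X t = -1}) :
    IsSymmetricRV X μ := by
  unfold IsSymmetricRV
  have h' : ∀ᵐ t ∂μ, -X t = 1 ∨ -X t = 0 ∨ -X t = -1 := by
    filter_upwards [h] with t ht
    rcases ht with e | e | e <;> simp [e]
  rw [map_eq_of_ae_mem_signs hX h, map_eq_of_ae_mem_signs (X := fun t => -X t) hX.neg h']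
  simp only [neg_eq_zero, neg_inj]
  have e1 : {t | -X t = 1} = {t | X t = -1} := by
    ext t
    simp [neg_eq_iff_eq_neg]
  rw [e1, he]

/-- Division by `a n` normalises the values. The law is then carried by three atoms, so equal masses
at `1` and `-1` already give symmetry. -/
theorem exists_isSignSystem_of_isSymmThreeValued {f : ℕ → ℝ → 𝕜} (hf : ∀ n, IsSymmThreeValued (f n))
    (hind : iIndepFun f unitMeasure) :
    ∃ a : ℕ → 𝕜, (∀ n, a n ≠ 0) ∧
      IsSignSystem (fun n t => (a n)⁻¹ * f n t) unitMeasure := by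
  choose hm a ha hmem heq hpos using hf
  have hmem' : ∀ n, ∀ᵐ t ∂unitMeasure,
      (a n)⁻¹ * f n t = 1 ∨ (a n)⁻¹ * f n t = 0 ∨ (a n)⁻¹ * f n t = -1 := fun n => by
    filter_upwards [hmem n] with t ht
    rcases ht with e | e | e <;> simp [e, ha n]
  have hm' : ∀ n, Measurable fun t => (a n)⁻¹ * f n t := fun n => (hm n).const_mul _
  have e1 : ∀ n, {t | (a n)⁻¹ * f n t = 1} = {t | f n t = a n} := fun n => by
    ext t
    simp [inv_mul_eq_iff_eq_mul₀ (ha n)]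
  have e2 : ∀ n, {t | (a n)⁻¹ * f n t = -1} = {t | f n t = -a n} := fun n => by
    ext t
    simp [inv_mul_eq_iff_eq_mul₀ (ha n)]
  refine ⟨a, ha, hm', hmem', fun n => ?_, ?_, fun n => ?_⟩
  · exact isSymmetricRV_of_measure_eq (hm' n) (hmem' n) (by rw [e1, e2, heq n])
  · exact hind.comp (fun n z => (a n)⁻¹ * z) fun n => by fun_prop
  · have hi : Integrable (fun t => ‖(a n)⁻¹ * f n t‖) unitMeasure := by
      refine (Integrable.of_bound (hm' n).aestronglyMeasurable 1 ?_).norm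
      filter_upwards [hmem' n] with t ht
      rcases ht with e | e | e <;> simp [e]
    refine (integral_pos_iff_support_of_nonneg (fun t => norm_nonneg _) hi).2
      ((hpos n).trans_le (measure_mono fun t ht => ?_))
    have : f n t = a n := ht
    simp [this, ha n]

theorem closedSpan_eq_lpSpan {f : ℕ → ℝ → 𝕜} {a : ℕ → 𝕜} (ha : ∀ n, a n ≠ 0)
    (hu : IsSignSystem (fun n t => (a n)⁻¹ * f n t) unitMeasure) (r : ℝ≥0∞) [Fact (1 ≤ r)] :
    closedSpan f r = hu.lpSpan r := by
  have hae : ∀ n, ((a n • hu.lpFun r n : Lp 𝕜 r unitMeasure) : ℝ → 𝕜) =ᵐ[unitMeasure] f n :=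
    fun n => by
      filter_upwards [Lp.coeFn_smul (a n) (hu.lpFun r n), hu.coeFn_lpFun r n] with t h1 h2
      rw [h1, Pi.smul_apply, h2, smul_eq_mul, mul_inv_cancel_left₀ (ha n)]
  unfold closedSpan IsSignSystem.lpSpan
  congr 1
  refine le_antisymm (Submodule.span_le.2 ?_) (Submodule.span_le.2 ?_)
  · rintro g ⟨n, hg⟩
    rw [Lp.ext (hg.trans (hae n).symm)]
    exact Submodule.smul_mem _ _ (Submodule.subset_span ⟨n, rfl⟩)
  · rintro _ ⟨n, rfl⟩
    have h1 : a n • hu.lpFun r n ∈ Submodule.span 𝕜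
        {g : Lp 𝕜 r unitMeasure | ∃ n, (g : ℝ → 𝕜) =ᵐ[unitMeasure] f n} :=
      Submodule.subset_span ⟨n, hae n⟩
    have h2 := Submodule.smul_mem _ (a n)⁻¹ h1
    rwa [inv_smul_smul₀ (ha n)] at h2

/-- The bound for the norms of the projections. -/
def orthoProjConst (p : ℝ≥0∞) : ℝ :=
  if p = 2 then 1 else
    max (IsSignSystem.projConst p.toReal) (IsSignSystem.projConst p.conjExponent.toReal)

theorem orthoProjConst_eq {p q : ℝ≥0∞} (h : p.HolderConjugate q) :
    orthoProjConst p = orthoProjConst q := by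
  have h2 : p = 2 ↔ q = 2 := by
    have h22 : (2 : ℝ≥0∞).conjExponent = 2 := by
      have : ENNReal.HolderConjugate 2 2 := inferInstance
      exact this.conjExponent_eq
    constructor
    · rintro rfl
      rw [← h.conjExponent_eq, h22]
    · rintro rfl
      rw [← h.symm.conjExponent_eq, h22]
  unfold orthoProjConst
  rw [h.conjExponent_eq, h.symm.conjExponent_eq, max_comm]
  simp only [h2]

theorem IsSignSystem.IsOrthoProjection.mono {Ω : Type*} [MeasurableSpace Ω] {μ : Measure Ω}
    [IsProbabilityMeasure μ] {u : ℕ → Ω → 𝕜} {hu : IsSignSystem u μ} {p : ℝ≥0∞} [Fact (1 ≤ p)]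
    {C D : ℝ} {P : Lp 𝕜 p μ →L[𝕜] Lp 𝕜 p μ} (h : hu.IsOrthoProjection p C P) (hCD : C ≤ D) :
    hu.IsOrthoProjection p D P :=
  ⟨h.1, h.2.1, h.2.2.1.trans hCD, h.2.2.2⟩

/-- Above `2` the constant is the Rosenthal one, below `2` that of the conjugate exponent; the
maximum of the two is symmetric under conjugation. At `2` the orthogonal projection itself has norm
at most `1`. -/
theorem IsSignSystem.exists_isOrthoProjection [IsProbabilityMeasure μ] {u : ℕ → Ω → 𝕜}
    (hu : IsSignSystem u μ) (p : ℝ≥0∞) [Fact (1 ≤ p)] (hp1 : 1 < p) (hpt : p < ∞) :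
    ∃ P, hu.IsOrthoProjection p (orthoProjConst p) P := by
  have two_le : ∀ q : ℝ≥0∞, 2 ≤ q → q ≠ ∞ → 2 ≤ q.toReal := fun q hq hqt => by
    simpa using ENNReal.toReal_mono hqt hq
  rcases lt_trichotomy p 2 with h | h | h
  · have hpq := ENNReal.HolderConjugate.conjExponent hp1.le
    set q := p.conjExponent with hq
    have : Fact (1 ≤ q) := ⟨hpq.symm.one_le⟩
    have hp1' : 1 < p.toReal := by
      simpa using (ENNReal.toReal_lt_toReal ENNReal.one_ne_top hpt.ne).2 hp1
    have hqt : q ≠ ∞ := by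
      intro e
      rw [e] at hpq
      exact hp1.ne' (by simpa using hpq.inv_add_inv_eq_one)
    have hpqR : p.toReal.HolderConjugate q.toReal := by
      refine Real.holderConjugate_iff.2 ⟨hp1', ?_⟩
      have := congrArg ENNReal.toReal hpq.inv_add_inv_eq_one
      rwa [ENNReal.toReal_add (by simpa using (zero_lt_one.trans hp1).ne')
        (by simpa using (zero_lt_one.trans_le hpq.symm.one_le).ne'), ENNReal.toReal_inv,
        ENNReal.toReal_inv, ENNReal.toReal_one] at this
    have hp2R : p.toReal < 2 := by
      simpa using (ENNReal.toReal_lt_toReal hpt.ne (by simp)).2 h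
    have hq2R : 2 ≤ q.toReal := by
      have h1 := hpqR.symm.sub_one_mul_conj
      nlinarith [hpqR.symm.sub_one_pos]
    have hq2 : 2 ≤ q := by
      rw [← ENNReal.ofReal_toReal hqt]
      simpa using ENNReal.ofReal_le_ofReal hq2R
    obtain ⟨P, hP⟩ := hu.exists_isOrthoProjection_of_dual hpqR h.le
      (hu.isOrthoProjection_of_two_le hq2R hq2)
    refine ⟨P, hP.mono ?_⟩
    rw [orthoProjConst, if_neg h.ne]
    exact le_max_right _ _
  · subst h
    refine ⟨_, hu.isOrthoProjection_two.mono ?_⟩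
    rw [orthoProjConst, if_pos rfl]
  · refine ⟨_, (hu.isOrthoProjection_of_two_le (two_le p h.le hpt.ne) h.le).mono ?_⟩
    rw [orthoProjConst, if_neg h.ne']
    exact le_max_left _ _

end ThreeValued

/-! ### Sign systems with prescribed masses on `(0, 1)` -/

section Existence

variable {𝕜 : Type*} [RCLike 𝕜]

theorem map_projIcc_unitMeasure :
    unitMeasure.map (Set.projIcc (0 : ℝ) 1 zero_le_one) = volume := by
  have h1 : (volume : Measure (Set.Icc (0 : ℝ) 1)).map Subtype.val = unitMeasure := by
    rw [unitMeasure, Measure.restrict_congr_set Ioo_ae_eq_Icc]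
    exact map_comap_subtype_coe measurableSet_Icc _
  rw [← h1, Measure.map_map continuous_projIcc.measurable measurable_subtype_coe]
  have : Set.projIcc (0 : ℝ) 1 zero_le_one ∘ Subtype.val = id := by
    ext t
    simp
  rw [this, Measure.map_id]

/-- The law of a symmetric random variable with values in `{1, 0, -1}`, nonzero with
probability `m`. -/
def signLaw (𝕜 : Type*) [RCLike 𝕜] (m : ℝ) : Measure 𝕜 :=
  ENNReal.ofReal (m / 2) • Measure.dirac 1 + (ENNReal.ofReal (m / 2) • Measure.dirac (-1)
    + ENNReal.ofReal (1 - m) • Measure.dirac 0)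

theorem isProbabilityMeasure_signLaw {m : ℝ} (h0 : 0 ≤ m) (h1 : m ≤ 1) :
    IsProbabilityMeasure (signLaw 𝕜 m) := by
  refine ⟨?_⟩
  simp only [signLaw, Measure.add_apply, Measure.smul_apply, measure_univ, smul_eq_mul, mul_one]
  rw [← ENNReal.ofReal_add (by linarith) (by linarith), ← ENNReal.ofReal_add (by linarith)
    (by linarith), show m / 2 + (m / 2 + (1 - m)) = 1 by ring, ENNReal.ofReal_one]

theorem ae_signLaw (m : ℝ) : ∀ᵐ z ∂(signLaw 𝕜 m), z = 1 ∨ z = 0 ∨ z = -1 := by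
  simp only [signLaw, ae_add_measure_iff]
  refine ⟨Measure.ae_smul_measure ?_ _, Measure.ae_smul_measure ?_ _,
    Measure.ae_smul_measure ?_ _⟩ <;> simp [ae_dirac_eq]

theorem map_neg_signLaw (m : ℝ) : (signLaw 𝕜 m).map (fun z => -z) = signLaw 𝕜 m := by
  have hm : Measurable fun z : 𝕜 => -z := measurable_neg
  simp only [signLaw, Measure.map_add _ _ hm, Measure.map_smul, Measure.map_dirac' hm, neg_neg,
    neg_zero]
  rw [← add_assoc, ← add_assoc, add_comm (_ • Measure.dirac (-1))]

theorem integral_norm_signLaw {m : ℝ} (h0 : 0 ≤ m) : ∫ z, ‖z‖ ∂(signLaw 𝕜 m) = m := by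
  have hi : ∀ (c : ℝ) (a : 𝕜),
      Integrable (fun z : 𝕜 => ‖z‖) (ENNReal.ofReal c • Measure.dirac a) := fun c a =>
    (integrable_dirac (by simp)).smul_measure ENNReal.ofReal_ne_top
  rw [signLaw, integral_add_measure (hi _ _) ((hi _ _).add_measure (hi _ _)),
    integral_add_measure (hi _ _) (hi _ _), integral_smul_measure, integral_smul_measure,
    integral_smul_measure, integral_dirac, integral_dirac, integral_dirac,
    ENNReal.toReal_ofReal (by linarith)]
  simp

theorem exists_isSignSystem (𝕜 : Type*) [RCLike 𝕜] {m : ℕ → ℝ} (h0 : ∀ n, 0 < m n)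
    (h1 : ∀ n, m n ≤ 1) :
    ∃ u : ℕ → ℝ → 𝕜, IsSignSystem u unitMeasure ∧ ∀ n, signMass u unitMeasure n = m n := by
  have hprob : ∀ n, IsProbabilityMeasure (signLaw 𝕜 (m n)) := fun n =>
    isProbabilityMeasure_signLaw (h0 n).le (h1 n)
  -- The infinite product law is the image of Lebesgue measure on the unit interval under a
  -- measurable map; its coordinates are the required variables.
  obtain ⟨g, hg, hgmap⟩ := (Measure.infinitePi fun n => signLaw 𝕜 (m n)).exists_measurable_map_eq
  set T : ℝ → ℕ → 𝕜 := fun t => g (Set.projIcc (0 : ℝ) 1 zero_le_one t) with hT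
  have hTm : Measurable T := hg.comp continuous_projIcc.measurable
  have hTmap : unitMeasure.map T = Measure.infinitePi fun n => signLaw 𝕜 (m n) := by
    rw [← hgmap, ← map_projIcc_unitMeasure]
    exact (Measure.map_map hg continuous_projIcc.measurable).symm
  set u : ℕ → ℝ → 𝕜 := fun n t => T t n with hu
  have hum : ∀ n, Measurable (u n) := fun n => (measurable_pi_apply n).comp hTm
  have hlaw : ∀ n, unitMeasure.map (u n) = signLaw 𝕜 (m n) := fun n => by
    have : (unitMeasure.map T).map (fun x => x n) = unitMeasure.map (u n) :=
      Measure.map_map (measurable_pi_apply n) hTm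
    rw [← this, hTmap]
    exact Measure.infinitePi_map_eval _ n
  have hmass : ∀ n, signMass u unitMeasure n = m n := fun n => by
    have := integral_map (μ := unitMeasure) (hum n).aemeasurable (f := fun z : 𝕜 => ‖z‖)
      (by fun_prop)
    rw [signMass, ← this, hlaw, integral_norm_signLaw (h0 n).le]
  refine ⟨u, ⟨hum, fun n => ?_, fun n => ?_, ?_, fun n => ?_⟩, hmass⟩
  · refine ae_of_ae_map (f := u n) (hum n).aemeasurable (p := fun z => z = 1 ∨ z = 0 ∨ z = -1) ?_
    rw [hlaw]
    exact ae_signLaw _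
  · have h2 : unitMeasure.map (fun t => -u n t) = (unitMeasure.map (u n)).map (fun z => -z) :=
      (Measure.map_map measurable_neg (hum n)).symm
    unfold IsSymmetricRV
    rw [h2, hlaw, map_neg_signLaw]
  · refine (iIndepFun_iff_map_fun_eq_infinitePi_map hum).2 ?_
    simp only [hlaw]
    exact hTmap
  · change 0 < signMass u unitMeasure n
    rw [hmass]
    exact h0 n

end Existence

/-! ### Embedding `X_{p,w}` as a complemented subspace of `L^p` -/

namespace Xpw

variable {𝕜 : Type*} [RCLike 𝕜] {p : ℝ≥0∞} {w w' : ℕ → ℝ} [hp : Fact (1 ≤ p)]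

/-- The diagonal operator with entries `d n`. -/
def diagOp (hp0 : 0 < p.toReal) (d : ℕ → 𝕜) (C : ℝ) (hC : 0 ≤ C)
    (h1 : ∀ (x : Xpw 𝕜 p w) (F : Finset ℕ),
      ∑ n ∈ F, ‖d n * coord n x‖ ^ p.toReal ≤ (C * ‖x‖) ^ p.toReal)
    (h2 : ∀ (x : Xpw 𝕜 p w) (F : Finset ℕ),
      ∑ n ∈ F, ‖(w' n : 𝕜) * (d n * coord n x)‖ ^ 2 ≤ (C * ‖x‖) ^ 2) :
    Xpw 𝕜 p w →L[𝕜] Xpw 𝕜 p w' :=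
  LinearMap.mkContinuous
    { toFun := fun x => ⟨fun n => d n * coord n x, mem_xpwSubmodule_of_sum_le (h1 x) (h2 x)⟩
      map_add' := fun x y => Subtype.ext <| funext fun n => by
        change d n * coord n (x + y) = d n * coord n x + d n * coord n y
        rw [map_add, mul_add]
      map_smul' := fun c x => Subtype.ext <| funext fun n => by
        change d n * coord n (c • x) = c * (d n * coord n x)
        rw [map_smul, smul_eq_mul, mul_left_comm] } C fun x =>
    norm_le_of_sum_le hp0 (by positivity) _ (h1 x) (h2 x)

theorem coord_diagOp {hp0 : 0 < p.toReal} {d : ℕ → 𝕜} {C : ℝ} {hC : 0 ≤ C}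
    {h1 : ∀ (x : Xpw 𝕜 p w) (F : Finset ℕ),
      ∑ n ∈ F, ‖d n * coord n x‖ ^ p.toReal ≤ (C * ‖x‖) ^ p.toReal}
    {h2 : ∀ (x : Xpw 𝕜 p w) (F : Finset ℕ),
      ∑ n ∈ F, ‖(w' n : 𝕜) * (d n * coord n x)‖ ^ 2 ≤ (C * ‖x‖) ^ 2} (x : Xpw 𝕜 p w) (n : ℕ) :
    coord n (diagOp hp0 d C hC h1 h2 x) = d n * coord n x := rfl

theorem norm_diagOp_le {hp0 : 0 < p.toReal} {d : ℕ → 𝕜} {C : ℝ} {hC : 0 ≤ C}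
    {h1 : ∀ (x : Xpw 𝕜 p w) (F : Finset ℕ),
      ∑ n ∈ F, ‖d n * coord n x‖ ^ p.toReal ≤ (C * ‖x‖) ^ p.toReal}
    {h2 : ∀ (x : Xpw 𝕜 p w) (F : Finset ℕ),
      ∑ n ∈ F, ‖(w' n : 𝕜) * (d n * coord n x)‖ ^ 2 ≤ (C * ‖x‖) ^ 2} :
    ‖diagOp hp0 d C hC h1 h2‖ ≤ C :=
  LinearMap.mkContinuous_norm_le _ hC _

/-- The weighted sequence has `ℓ^2` norm at most `‖x‖`, and the `ℓ^p` norm is no larger than the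
`ℓ^2` norm. -/
theorem sum_norm_mul_coord_rpow_le (hp2 : 2 ≤ p.toReal) (x : Xpw 𝕜 p w) (F : Finset ℕ) :
    ∑ n ∈ F, ‖(w n : 𝕜) * coord n x‖ ^ p.toReal ≤ ‖x‖ ^ p.toReal := by
  have hn : ∀ n, ‖(w n : 𝕜) * coord n x‖ ≤ ‖x‖ := fun n => by
    have h := x.sum_norm_mul_coord_sq_le {n}
    rw [Finset.sum_singleton] at h
    exact (sq_le_sq₀ (norm_nonneg _) (norm_nonneg _)).1 h
  have key : ∀ a : ℝ, 0 ≤ a → a ^ p.toReal = a ^ 2 * a ^ (p.toReal - 2) := fun a ha => by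
    rw [← Real.rpow_two, ← Real.rpow_add_of_nonneg ha (by norm_num) (by linarith)]
    congr 1
    ring
  calc ∑ n ∈ F, ‖(w n : 𝕜) * coord n x‖ ^ p.toReal
      ≤ ∑ n ∈ F, ‖(w n : 𝕜) * coord n x‖ ^ 2 * ‖x‖ ^ (p.toReal - 2) :=
        Finset.sum_le_sum fun n _ => by
          rw [key _ (norm_nonneg _)]
          exact mul_le_mul_of_nonneg_left
            (Real.rpow_le_rpow (norm_nonneg _) (hn n) (by linarith)) (sq_nonneg _)
    _ = (∑ n ∈ F, ‖(w n : 𝕜) * coord n x‖ ^ 2) * ‖x‖ ^ (p.toReal - 2) := by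
        rw [Finset.sum_mul]
    _ ≤ ‖x‖ ^ 2 * ‖x‖ ^ (p.toReal - 2) :=
        mul_le_mul_of_nonneg_right (x.sum_norm_mul_coord_sq_le F) (by positivity)
    _ = ‖x‖ ^ p.toReal := (key _ (norm_nonneg _)).symm

/-- The weights of a sign system are at most `1`, so large weights must be removed. Multiplication
by `max (w n) 1` does this: `min * max = w` preserves the weighted part, and where `w n ≥ 1` the new
`ℓ^p` part is controlled by the old weighted `ℓ^2` part. -/
theorem exists_comp_eq_id_of_min_one (w : ℕ → ℝ) (hp2 : 2 ≤ p.toReal) :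
    ∃ (U : Xpw 𝕜 p w →L[𝕜] Xpw 𝕜 p fun n => min (w n) 1)
      (V : (Xpw 𝕜 p fun n => min (w n) 1) →L[𝕜] Xpw 𝕜 p w), ∀ x, V (U x) = x := by
  have hp0 : 0 < p.toReal := by linarith
  set d : ℕ → ℝ := fun n => max (w n) 1 with hd
  have hd1 : ∀ n, 1 ≤ d n := fun n => le_max_right _ _
  have hd0 : ∀ n, 0 < d n := fun n => zero_lt_one.trans_le (hd1 n)
  have hmd : ∀ n, min (w n) 1 * d n = w n := fun n => by rw [hd, min_mul_max, mul_one]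
  have hUw : ∀ (x : Xpw 𝕜 p w) (n : ℕ),
      ((min (w n) 1 : ℝ) : 𝕜) * ((d n : 𝕜) * coord n x) = (w n : 𝕜) * coord n x := fun x n => by
    rw [← mul_assoc, ← RCLike.ofReal_mul, hmd]
  have hVw : ∀ (y : Xpw 𝕜 p fun n => min (w n) 1) (n : ℕ),
      (w n : 𝕜) * (((d n)⁻¹ : ℝ) * coord n y) = ((min (w n) 1 : ℝ) : 𝕜) * coord n y := fun y n => by
    nth_rewrite 1 [← hmd n]
    rw [← mul_assoc, ← RCLike.ofReal_mul, mul_inv_cancel_right₀ (hd0 n).ne']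
  refine ⟨diagOp hp0 (fun n => (d n : 𝕜)) 2 (by norm_num) (fun x F => ?_) (fun x F => ?_),
    diagOp hp0 (fun n => (((d n)⁻¹ : ℝ) : 𝕜)) 1 zero_le_one (fun y F => ?_) (fun y F => ?_),
    fun x => ext_coord fun n => ?_⟩
  · calc ∑ n ∈ F, ‖(d n : 𝕜) * coord n x‖ ^ p.toReal
        ≤ ∑ n ∈ F, (‖coord n x‖ ^ p.toReal + ‖(w n : 𝕜) * coord n x‖ ^ p.toReal) :=
          Finset.sum_le_sum fun n _ => by
            rcases le_total (w n) 1 with h | h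
            · rw [show d n = 1 from max_eq_right h, RCLike.ofReal_one, one_mul]
              exact le_add_of_nonneg_right (by positivity)
            · rw [show d n = w n from max_eq_left h]
              exact le_add_of_nonneg_left (by positivity)
      _ ≤ ‖x‖ ^ p.toReal + ‖x‖ ^ p.toReal := by
          rw [Finset.sum_add_distrib]
          exact add_le_add (x.sum_norm_coord_rpow_le hp0 F) (x.sum_norm_mul_coord_rpow_le hp2 F)
      _ ≤ (2 * ‖x‖) ^ p.toReal := by
          have h2 : (2 : ℝ) ≤ 2 ^ p.toReal := by
            simpa using Real.rpow_le_rpow_of_exponent_le one_le_two (by linarith : 1 ≤ p.toReal)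
          rw [Real.mul_rpow zero_le_two (norm_nonneg _), ← two_mul]
          exact mul_le_mul_of_nonneg_right h2 (by positivity)
  · simp only [hUw]
    refine (x.sum_norm_mul_coord_sq_le F).trans (pow_le_pow_left₀ (norm_nonneg _) ?_ 2)
    linarith [norm_nonneg x]
  · rw [one_mul]
    refine (Finset.sum_le_sum fun n _ => ?_).trans (y.sum_norm_coord_rpow_le hp0 F)
    refine Real.rpow_le_rpow (norm_nonneg _) ?_ hp0.le
    rw [norm_mul, RCLike.norm_ofReal, abs_of_nonneg (inv_nonneg.2 (hd0 n).le)]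
    exact mul_le_of_le_one_left (norm_nonneg _) (inv_le_one_of_one_le₀ (hd1 n))
  · simp only [hVw]
    rw [one_mul]
    exact y.sum_norm_mul_coord_sq_le F
  · rw [coord_diagOp, coord_diagOp, ← mul_assoc, ← RCLike.ofReal_mul,
      inv_mul_cancel₀ (hd0 n).ne', RCLike.ofReal_one, one_mul]

theorem exists_embedding_unitMeasure (hp2 : 2 < p.toReal) (hw : ∀ n, 0 < w n) :
    ∃ (U : Xpw 𝕜 p w →L[𝕜] Lp 𝕜 p unitMeasure) (V : Lp 𝕜 p unitMeasure →L[𝕜] Xpw 𝕜 p w),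
      ∀ x, V (U x) = x := by
  have hp0 : 0 < p.toReal := by linarith
  set θ : ℝ := 1 / 2 - 1 / p.toReal with hθ
  have hθ0 : 0 < θ := sub_pos.2 (one_div_lt_one_div_of_lt two_pos hp2)
  have hm0 : ∀ n, 0 < min (w n) 1 := fun n => lt_min (hw n) one_pos
  -- A sign system of masses `m n` has weights `m n ^ θ`; the exponent `θ⁻¹` makes them equal to
  -- `min (w n) 1`. Here `θ > 0` because `p > 2`.
  obtain ⟨u, hu, hmass⟩ := exists_isSignSystem 𝕜 (m := fun n => min (w n) 1 ^ θ⁻¹)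
    (fun n => Real.rpow_pos_of_pos (hm0 n) _)
    (fun n => Real.rpow_le_one (hm0 n).le (min_le_right _ _) (inv_nonneg.2 hθ0.le))
  have hweight : (fun n => min (w n) 1) = signWeight u unitMeasure p.toReal := by
    funext n
    rw [signWeight, hmass, ← hθ, Real.rpow_inv_rpow (hm0 n).le hθ0.ne']
  have hUV := exists_comp_eq_id_of_min_one (𝕜 := 𝕜) w hp2.le
  rw [hweight] at hUV
  obtain ⟨U, V, h⟩ := hUV
  exact ⟨hu.synthOp hp2.le ∘L U, V ∘L hu.coefOp hp2.le, fun x => by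
    rw [ContinuousLinearMap.comp_apply, ContinuousLinearMap.comp_apply, hu.coefOp_synthOp, h]⟩

end Xpw

section Complemented

variable {𝕜 : Type*} [RCLike 𝕜] {X E : Type*} [NormedAddCommGroup X] [NormedSpace 𝕜 X]
  [NormedAddCommGroup E] [NormedSpace 𝕜 E]

/-- `U ∘ V` is a projection onto the range of `U`, and `V` inverts `U` there. -/
theorem isomorphicToComplemented_of_leftInverse (U : X →L[𝕜] E) (V : E →L[𝕜] X)
    (h : ∀ x, V (U x) = x) : IsomorphicToComplemented 𝕜 X E := by
  refine ⟨U.range, ⟨(U ∘L V).codRestrict U.range fun e => ⟨V e, rfl⟩, ?_⟩,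
    ⟨ContinuousLinearEquiv.equivOfInverse (U.codRestrict U.range fun x => ⟨x, rfl⟩)
      (V ∘L U.range.subtypeL) (fun x => h x) ?_⟩⟩
  · rintro ⟨_, x, rfl⟩
    exact Subtype.ext (congrArg U (h x))
  · rintro ⟨_, x, rfl⟩
    exact Subtype.ext (congrArg U (h x))

end Complemented

/-! ### Finite-dimensional subspaces of `L^p` -/

section LocalStructure

variable {𝕜 : Type*} [RCLike 𝕜] {Ω : Type*} [MeasurableSpace Ω] {μ : Measure Ω}
  [IsProbabilityMeasure μ] {p : ℝ≥0∞} [hp1 : Fact (1 ≤ p)]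

theorem norm_sum_rpow_of_subsingleton {ι : Type*} [Fintype ι] {r : ℝ} (hr : r ≠ 0) (z : ι → 𝕜)
    (h : ∀ i j, z i ≠ 0 → z j ≠ 0 → i = j) : ‖∑ i, z i‖ ^ r = ∑ i, ‖z i‖ ^ r := by
  by_cases hz : ∃ i, z i ≠ 0
  · obtain ⟨i, hi⟩ := hz
    have h0 : ∀ j, j ≠ i → z j = 0 := fun j hj => by
      by_contra hne
      exact hj (h j i hne hi)
    rw [Finset.sum_eq_single i (fun j _ hj => h0 j hj) (by simp),
      Finset.sum_eq_single i (fun j _ hj => by rw [h0 j hj, norm_zero, Real.zero_rpow hr])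
        (by simp)]
  · push Not at hz
    simp [hz, Real.zero_rpow hr]

/-- Indicators of disjoint sets, divided by `μ (A i) ^ (1 / p)`, span `ℓ^p` isometrically. -/
theorem exists_isometry_of_disjoint (hp0 : 0 < p.toReal) {ι : Type*} [Fintype ι] {A : ι → Set Ω}
    (hA : ∀ i, MeasurableSet (A i)) (hd : ∀ i j t, t ∈ A i → t ∈ A j → i = j)
    (hpos : ∀ i, μ (A i) ≠ 0) :
    ∃ α : PiLp p (fun _ : ι => 𝕜) →L[𝕜] Lp 𝕜 p μ, (∀ a, ‖α a‖ = ‖a‖) ∧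
      ∀ c : ι → 𝕜, ∃ a, (α a : Ω → 𝕜) =ᵐ[μ] fun t => ∑ i, (A i).indicator (fun _ => c i) t := by
  have hm : ∀ i, 0 < μ.real (A i) := fun i =>
    ENNReal.toReal_pos (hpos i) (measure_ne_top μ _)
  set ρ : ι → ℝ := fun i => (μ.real (A i) ^ (1 / p.toReal))⁻¹ with hρ
  have hρ0 : ∀ i, 0 < ρ i := fun i => inv_pos.2 (Real.rpow_pos_of_pos (hm i) _)
  set e : ι → Lp 𝕜 p μ := fun i => indicatorConstLp p (hA i) (measure_ne_top μ _) (ρ i : 𝕜) with he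
  set L : PiLp p (fun _ : ι => 𝕜) →ₗ[𝕜] Lp 𝕜 p μ :=
    { toFun := fun a => ∑ i, a i • e i
      map_add' := fun a b => by simp [add_smul, Finset.sum_add_distrib]
      map_smul' := fun c a => by simp [mul_smul, Finset.smul_sum] } with hL
  have hae : ∀ a, (L a : Ω → 𝕜) =ᵐ[μ]
      fun t => ∑ i, (A i).indicator (fun _ => a i * (ρ i : 𝕜)) t := fun a => by
    have hall : ∀ᵐ t ∂μ, ∀ i, (a i • e i : Lp 𝕜 p μ) t =
        (A i).indicator (fun _ => a i * (ρ i : 𝕜)) t := by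
      refine ae_all_iff.2 fun i => ?_
      filter_upwards [Lp.coeFn_smul (a i) (e i), indicatorConstLp_coeFn (p := p) (hs := hA i)
        (hμs := measure_ne_top μ _) (c := (ρ i : 𝕜))] with t h1 h2
      rw [h1, Pi.smul_apply, he, h2, smul_eq_mul]
      by_cases ht : t ∈ A i <;> simp [ht]
    filter_upwards [Lp.coeFn_finsetSum Finset.univ fun i => a i • e i, hall] with t h1 h2
    change (∑ i, a i • e i : Lp 𝕜 p μ) t = _
    rw [h1, Finset.sum_apply]
    exact Finset.sum_congr rfl fun i _ => h2 i
  have hnorm : ∀ a, ‖L a‖ = ‖a‖ := fun a => by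
    have h1 : ‖L a‖ ^ p.toReal = ∑ i, ‖a i‖ ^ p.toReal := by
      rw [Lp.norm_rpow_toReal hp0]
      have h2 : ∀ᵐ t ∂μ, ‖L a t‖ ^ p.toReal =
          ∑ i, (A i).indicator (fun _ => ‖a i‖ ^ p.toReal * (μ.real (A i))⁻¹) t := by
        filter_upwards [hae a] with t ht
        rw [ht, norm_sum_rpow_of_subsingleton hp0.ne']
        · refine Finset.sum_congr rfl fun i _ => ?_
          by_cases hti : t ∈ A i
          · rw [Set.indicator_of_mem hti, Set.indicator_of_mem hti, norm_mul, RCLike.norm_ofReal,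
              abs_of_pos (hρ0 i), Real.mul_rpow (norm_nonneg _) (hρ0 i).le, hρ,
              Real.inv_rpow (Real.rpow_nonneg (hm i).le _), ← Real.rpow_mul (hm i).le,
              one_div_mul_cancel hp0.ne', Real.rpow_one]
          · simp [hti, Real.zero_rpow hp0.ne']
        · intro i j hi hj
          exact hd i j t (Set.mem_of_indicator_ne_zero hi) (Set.mem_of_indicator_ne_zero hj)
      rw [integral_congr_ae h2, integral_finsetSum _ fun i _ =>
        (integrable_const _).indicator (hA i)]
      refine Finset.sum_congr rfl fun i _ => ?_
      rw [integral_indicator (hA i), setIntegral_const, smul_eq_mul, mul_left_comm,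
        mul_inv_cancel₀ (hm i).ne', mul_one]
    have h3 : ‖a‖ ^ p.toReal = ∑ i, ‖a i‖ ^ p.toReal := by
      rw [PiLp.norm_eq_sum hp0, ← Real.rpow_mul (Finset.sum_nonneg fun i _ => by positivity),
        one_div_mul_cancel hp0.ne', Real.rpow_one]
    exact (Real.rpow_left_inj (norm_nonneg _) (norm_nonneg _) hp0.ne').1 (h1.trans h3.symm)
  refine ⟨L.mkContinuous 1 fun a => by rw [hnorm, one_mul], hnorm, fun c => ?_⟩
  refine ⟨WithLp.toLp p fun i => c i * ((ρ i)⁻¹ : ℝ), (hae _).trans ?_⟩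
  refine Filter.Eventually.of_forall fun t => Finset.sum_congr rfl fun i _ => ?_
  have : c i * (((ρ i)⁻¹ : ℝ) : 𝕜) * (ρ i : 𝕜) = c i := by
    rw [mul_assoc, ← RCLike.ofReal_mul, inv_mul_cancel₀ (hρ0 i).ne', RCLike.ofReal_one, mul_one]
  simp only [this]

theorem exists_isometry_simpleFunc (hp0 : 0 < p.toReal) {k : ℕ} (h : Fin k → SimpleFunc Ω 𝕜) :
    ∃ (n : ℕ) (α : PiLp p (fun _ : Fin n => 𝕜) →L[𝕜] Lp 𝕜 p μ), (∀ a, ‖α a‖ = ‖a‖) ∧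
      ∀ i, ∃ a, (α a : Ω → 𝕜) =ᵐ[μ] h i := by
  classical
  set H : Ω → Fin k → 𝕜 := fun t i => h i t with hH
  have hHm : ∀ v, MeasurableSet (H ⁻¹' {v}) := fun v => by
    have : H ⁻¹' {v} = ⋂ i, h i ⁻¹' {v i} := by
      ext t
      simp [hH, funext_iff]
    rw [this]
    exact MeasurableSet.iInter fun i => (h i).measurableSet_preimage _
  set R : Finset (Fin k → 𝕜) := Fintype.piFinset fun i => (h i).range with hR
  have hHR : ∀ t, H t ∈ R := fun t => by
    rw [hR, Fintype.mem_piFinset]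
    exact fun i => (h i).mem_range_self t
  -- The level sets of the joint value form a common partition for all the functions. Null pieces
  -- are dropped, since their indicators cannot be normalised.
  set I : Finset (Fin k → 𝕜) := R.filter fun v => μ (H ⁻¹' {v}) ≠ 0 with hI
  have hHI : ∀ᵐ t ∂μ, H t ∈ I := by
    have : ∀ᵐ t ∂μ, ∀ v ∈ R, μ (H ⁻¹' {v}) = 0 → H t ≠ v := by
      refine (Finset.eventually_all R).2 fun v _ => ?_
      by_cases hv : μ (H ⁻¹' {v}) = 0
      · filter_upwards [measure_eq_zero_iff_ae_notMem.1 hv] with t ht _ e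
        exact ht e
      · exact Filter.Eventually.of_forall fun t e => absurd e hv
    filter_upwards [this] with t ht
    exact Finset.mem_filter.2 ⟨hHR t, fun e => ht _ (hHR t) e rfl⟩
  obtain ⟨α, hα, hc⟩ := exists_isometry_of_disjoint (𝕜 := 𝕜) (μ := μ) (p := p) hp0
    (A := fun v : I => H ⁻¹' {v.1}) (fun v => hHm v.1)
    (fun v v' t h1 h2 => Subtype.ext (by
      have e1 : H t = v.1 := h1
      have e2 : H t = v'.1 := h2
      rw [← e1, e2]))
    (fun v => (Finset.mem_filter.1 v.2).2)
  let e := LinearIsometryEquiv.piLpCongrLeft p 𝕜 𝕜 (Fintype.equivFin I)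
  refine ⟨Fintype.card I, α ∘L (e.symm : PiLp p (fun _ : Fin (Fintype.card I) => 𝕜) →L[𝕜] _),
    fun a => ?_, fun i => ?_⟩
  · change ‖α (e.symm a)‖ = _
    rw [hα, LinearIsometryEquiv.norm_map]
  · obtain ⟨a, ha⟩ := hc fun v => v.1 i
    refine ⟨e a, ?_⟩
    change (α (e.symm (e a)) : Ω → 𝕜) =ᵐ[μ] h i
    rw [LinearIsometryEquiv.symm_apply_apply]
    filter_upwards [ha, hHI] with t h1 h2
    rw [h1, Finset.sum_eq_single (⟨H t, h2⟩ : I)]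
    · rw [Set.indicator_of_mem (by simp)]
    · intro v _ hv
      refine Set.indicator_of_notMem (fun ht => hv (Subtype.ext ?_)) _
      exact (Set.mem_singleton_iff.1 ht).symm
    · simp

theorem exists_isometry_approx (hp0 : 0 < p.toReal) {k : ℕ} (g : Fin k → Lp 𝕜 p μ) {ε : ℝ}
    (hε : 0 < ε) :
    ∃ (n : ℕ) (α : PiLp p (fun _ : Fin n => 𝕜) →L[𝕜] Lp 𝕜 p μ), (∀ a, ‖α a‖ = ‖a‖) ∧
      ∀ i, ∃ a, ‖α a - g i‖ ≤ ε := by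
  have hpt : p ≠ ∞ := (ENNReal.toReal_pos_iff.1 hp0).2.ne
  have hs : ∀ i, ∃ s : SimpleFunc Ω 𝕜,
      eLpNorm ((g i : Ω → 𝕜) - (s : Ω → 𝕜)) p μ < ENNReal.ofReal ε ∧ MemLp s p μ :=
    fun i => (Lp.memLp (g i)).exists_simpleFunc_eLpNorm_sub_lt hpt (by simpa using hε)
  choose s hs1 _ using hs
  obtain ⟨n, α, hα, h⟩ := exists_isometry_simpleFunc (𝕜 := 𝕜) (μ := μ) (p := p) hp0 s
  refine ⟨n, α, hα, fun i => ?_⟩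
  obtain ⟨a, ha⟩ := h i
  refine ⟨a, ?_⟩
  rw [norm_sub_rev, Lp.norm_def]
  refine ENNReal.toReal_le_of_le_ofReal hε.le (le_trans (le_of_eq (eLpNorm_congr_ae ?_)) (hs1 i).le)
  filter_upwards [Lp.coeFn_sub (g i) (α a), ha] with t h1 h2
  rw [h1, Pi.sub_apply, Pi.sub_apply, h2]

/-- The coordinates on `Z` extend to bounded functionals `c i` on `E`, because `Z` is complemented.
The operator `1 - ∑ c i ⊗ (b i - g i)` moves each `b i` to `g i`; for `ε = 1 / (2 * (M + 1))` the
sum has norm at most `1 / 2`, whence invertibility and the constants `2`. -/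
theorem Submodule.exists_perturbation {E : Type*} [NormedAddCommGroup E] [NormedSpace 𝕜 E]
    [CompleteSpace E] (Z : Submodule 𝕜 E) [FiniteDimensional 𝕜 Z] :
    ∃ ε > 0, ∀ g : Fin (Module.finrank 𝕜 Z) → E,
      (∀ i, ‖g i - Module.finBasis 𝕜 Z i‖ ≤ ε) →
      ∃ A : E ≃L[𝕜] E, (∀ x, ‖A x‖ ≤ 2 * ‖x‖) ∧ (∀ x, ‖x‖ ≤ 2 * ‖A x‖) ∧
        ∀ i, A (Module.finBasis 𝕜 Z i) = g i := by
  set b := Module.finBasis 𝕜 Z with hb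
  obtain ⟨Q, hQ⟩ := Submodule.ClosedComplemented.of_finiteDimensional Z
  set c : Fin (Module.finrank 𝕜 Z) → (E →L[𝕜] 𝕜) := fun i =>
    (b.coord i).toContinuousLinearMap ∘L Q with hc
  set M := ∑ i, ‖c i‖ with hM
  have hM0 : 0 ≤ M := Finset.sum_nonneg fun i _ => norm_nonneg _
  refine ⟨1 / (2 * (M + 1)), by positivity, fun g hg => ?_⟩
  set D : E →L[𝕜] E := ∑ i, (c i).smulRight ((b i : E) - g i) with hD
  have hDn : ‖D‖ ≤ 1 / 2 := by
    calc ‖D‖ ≤ ∑ i, ‖c i‖ * (1 / (2 * (M + 1))) := by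
          refine (norm_sum_le _ _).trans (Finset.sum_le_sum fun i _ => ?_)
          rw [ContinuousLinearMap.norm_smulRight_apply, norm_sub_rev]
          exact mul_le_mul_of_nonneg_left (hg i) (norm_nonneg _)
      _ = M * (1 / (2 * (M + 1))) := by rw [← Finset.sum_mul]
      _ ≤ 1 / 2 := by
          rw [mul_one_div, div_le_div_iff₀ (by positivity) (by norm_num)]
          linarith
  have hDx : ∀ x, ‖D x‖ ≤ 1 / 2 * ‖x‖ := fun x =>
    (D.le_opNorm x).trans (mul_le_mul_of_nonneg_right hDn (norm_nonneg _))
  have hDb : ∀ i, D (b i) = b i - g i := fun i => by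
    rw [hD, sum_apply, Finset.sum_eq_single i]
    · simp [hc, hQ]
    · intro j _ hj
      simp [hc, hQ, Finsupp.single_eq_of_ne hj]
    · simp
  set A := ContinuousLinearEquiv.unitsEquiv 𝕜 E
    (Units.oneSub D (hDn.trans_lt (by norm_num))) with hA
  have hAv : ∀ x, A x = x - D x := fun x => rfl
  refine ⟨A, fun x => ?_, fun x => ?_, fun i => ?_⟩
  · rw [hAv]
    linarith [norm_sub_le x (D x), hDx x, norm_nonneg x]
  · rw [hAv]
    linarith [norm_sub_norm_le x (D x), hDx x, norm_nonneg x]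
  · rw [hAv, hDb, sub_sub_cancel]

/-- Every finite-dimensional subspace of `L^p` lies in one that is `4`-isomorphic to some
`ℓ^p_n`. -/
theorem exists_piLp_embedding_range_ge (hp0 : 0 < p.toReal) (Z : Submodule 𝕜 (Lp 𝕜 p μ))
    [FiniteDimensional 𝕜 Z] :
    ∃ (n : ℕ) (α : PiLp p (fun _ : Fin n => 𝕜) →L[𝕜] Lp 𝕜 p μ), (∀ a, ‖a‖ ≤ 2 * ‖α a‖) ∧
      (∀ a, ‖α a‖ ≤ 2 * ‖a‖) ∧ Z ≤ α.range := by
  obtain ⟨ε, hε, hZ⟩ := Z.exists_perturbation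
  obtain ⟨n, α, hα, happ⟩ := exists_isometry_approx (μ := μ) hp0
    (fun i => (Module.finBasis 𝕜 Z i : Lp 𝕜 p μ)) hε
  choose a ha using happ
  obtain ⟨A, hA1, hA2, hAb⟩ := hZ (fun i => α (a i)) ha
  refine ⟨n, (A.symm : Lp 𝕜 p μ →L[𝕜] Lp 𝕜 p μ) ∘L α, fun v => ?_, fun v => ?_, ?_⟩
  · have h := hA1 (A.symm (α v))
    rwa [A.apply_symm_apply, hα] at h
  · have h := hA2 (A.symm (α v))
    rwa [A.apply_symm_apply, hα] at h
  · set T := (A.symm : Lp 𝕜 p μ →L[𝕜] Lp 𝕜 p μ) ∘L α with hT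
    have hbT : ∀ i, (Module.finBasis 𝕜 Z i : Lp 𝕜 p μ) ∈ T.range := fun i => ⟨a i, by
      change A.symm (α (a i)) = _
      rw [← hAb, A.symm_apply_apply]⟩
    intro z hz
    have h1 := (Module.finBasis 𝕜 Z).sum_repr ⟨z, hz⟩
    have h2 := congrArg Subtype.val h1
    rw [Submodule.coe_sum] at h2
    change _ = z at h2
    rw [← h2]
    exact Submodule.sum_mem _ fun i _ => Submodule.smul_mem _ _ (hbT i)

end LocalStructure

/-! ### Truncations and copies of `ℓ^p_n` far out in `X_{p,w}` -/

namespace Xpw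

variable {𝕜 : Type*} [RCLike 𝕜] {p : ℝ≥0∞} {w : ℕ → ℝ} [hp : Fact (1 ≤ p)]

/-- The projection onto the first `N` coordinates. -/
def truncate (hp0 : 0 < p.toReal) (w : ℕ → ℝ) (N : ℕ) : Xpw 𝕜 p w →L[𝕜] Xpw 𝕜 p w :=
  diagOp hp0 (fun n => if n < N then 1 else 0) 1 zero_le_one
    (fun x F => by
      rw [one_mul]
      refine (Finset.sum_le_sum fun n _ => ?_).trans (x.sum_norm_coord_rpow_le hp0 F)
      refine Real.rpow_le_rpow (norm_nonneg _) ?_ hp0.le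
      split_ifs <;> simp)
    (fun x F => by
      rw [one_mul]
      refine (Finset.sum_le_sum fun n _ => ?_).trans (x.sum_norm_mul_coord_sq_le F)
      refine pow_le_pow_left₀ (norm_nonneg _) ?_ 2
      split_ifs
      · rw [one_mul]
      · simp only [zero_mul, mul_zero, norm_zero, norm_nonneg])

theorem coord_truncate (hp0 : 0 < p.toReal) (N : ℕ) (x : Xpw 𝕜 p w) (n : ℕ) :
    coord n (truncate hp0 w N x) = if n < N then coord n x else 0 := by
  have : coord n (truncate hp0 w N x) = (if n < N then 1 else 0) * coord n x := rfl
  rw [this]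
  split_ifs <;> simp

theorem norm_truncate_le (hp0 : 0 < p.toReal) (N : ℕ) (x : Xpw 𝕜 p w) :
    ‖truncate hp0 w N x‖ ≤ ‖x‖ := by
  have h := (truncate (𝕜 := 𝕜) hp0 w N).le_of_opNorm_le norm_diagOp_le x
  rwa [one_mul] at h

theorem exists_norm_sub_truncate_le (hp0 : 0 < p.toReal) (x : Xpw 𝕜 p w) {ε : ℝ} (hε : 0 < ε) :
    ∃ M, ∀ N, M ≤ N → ‖x - truncate hp0 w N x‖ ≤ ε := by
  obtain ⟨s1, hs1⟩ := summable_iff_vanishing_norm.1 (x.summable_norm_coord_rpow hp0)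
    (ε ^ p.toReal) (by positivity)
  obtain ⟨s2, hs2⟩ := summable_iff_vanishing_norm.1 x.summable_norm_mul_coord_sq
    (ε ^ 2) (by positivity)
  refine ⟨(s1 ∪ s2).sup id + 1, fun N hN => ?_⟩
  have hsN : ∀ n ∈ s1 ∪ s2, n < N := fun n hn =>
    (Nat.lt_succ_of_le (Finset.le_sup (f := id) hn)).trans_le hN
  have hc : ∀ n, coord n (x - truncate hp0 w N x) = if N ≤ n then coord n x else 0 := fun n => by
    rw [map_sub, coord_truncate]
    by_cases h : n < N
    · simp [h]
    · simp [h, not_lt.1 h]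
  have hdisj : ∀ F : Finset ℕ, Disjoint (F.filter (N ≤ ·)) (s1 ∪ s2) := fun F =>
    Finset.disjoint_left.2 fun n h1 h2 =>
      absurd (hsN n h2) (not_lt.2 (Finset.mem_filter.1 h1).2)
  refine norm_le_of_sum_le hp0 hε.le _ (fun F => ?_) fun F => ?_
  · refine le_trans (le_of_eq ?_) ((le_abs_self _).trans
      (hs1 (F.filter (N ≤ ·)) (Finset.disjoint_union_right.1 (hdisj F)).1).le)
    rw [Finset.sum_filter]
    refine Finset.sum_congr rfl fun n _ => ?_
    rw [hc]
    split_ifs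
    · rfl
    · rw [norm_zero, Real.zero_rpow hp0.ne']
  · refine le_trans (le_of_eq ?_) ((le_abs_self _).trans
      (hs2 (F.filter (N ≤ ·)) (Finset.disjoint_union_right.1 (hdisj F)).2).le)
    rw [Finset.sum_filter]
    refine Finset.sum_congr rfl fun n _ => ?_
    rw [hc]
    split_ifs
    · rfl
    · simp

/-- Truncations converge pointwise to the identity, hence uniformly on the unit ball of a
finite-dimensional `W`; `N` is chosen so that the error is at most half the norm. -/
theorem exists_norm_le_two_mul_norm_truncate (hp0 : 0 < p.toReal) (W : Submodule 𝕜 (Xpw 𝕜 p w))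
    [FiniteDimensional 𝕜 W] : ∃ N, ∀ y ∈ W, ‖y‖ ≤ 2 * ‖truncate hp0 w N y‖ := by
  set b := Module.finBasis 𝕜 W with hb
  set c : Fin (Module.finrank 𝕜 W) → (W →L[𝕜] 𝕜) := fun i =>
    (b.coord i).toContinuousLinearMap with hc
  set K := ∑ i, ‖c i‖ with hK
  have hK0 : 0 ≤ K := Finset.sum_nonneg fun i _ => norm_nonneg (c i)
  choose M hM using fun i => exists_norm_sub_truncate_le hp0 (b i : Xpw 𝕜 p w)
    (ε := 1 / (2 * (K + 1))) (by positivity)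
  refine ⟨Finset.univ.sup M, fun y hy => ?_⟩
  set N := Finset.univ.sup M with hN
  have hsum : y = ∑ i, c i ⟨y, hy⟩ • (b i : Xpw 𝕜 p w) := by
    have h2 := congrArg Subtype.val (b.sum_repr ⟨y, hy⟩)
    rw [Submodule.coe_sum] at h2
    exact h2.symm
  have h1 : ‖y - truncate hp0 w N y‖ ≤ 1 / 2 * ‖y‖ := by
    calc ‖y - truncate hp0 w N y‖
        = ‖∑ i, c i ⟨y, hy⟩ • ((b i : Xpw 𝕜 p w) - truncate hp0 w N (b i))‖ := by
          conv_lhs => rw [hsum]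
          simp only [map_sum, map_smul, smul_sub, Finset.sum_sub_distrib]
      _ ≤ ∑ i, ‖c i‖ * ‖y‖ * (1 / (2 * (K + 1))) := by
          refine (norm_sum_le _ _).trans (Finset.sum_le_sum fun i _ => ?_)
          rw [norm_smul]
          exact mul_le_mul ((c i).le_opNorm _) (hM i N (Finset.le_sup (Finset.mem_univ i)))
            (norm_nonneg _) (by positivity)
      _ = K * (1 / (2 * (K + 1))) * ‖y‖ := by
          rw [← Finset.sum_mul, ← Finset.sum_mul]
          ring
      _ ≤ 1 / 2 * ‖y‖ := by
          refine mul_le_mul_of_nonneg_right ?_ (norm_nonneg _)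
          rw [mul_one_div, div_le_div_iff₀ (by positivity) (by norm_num)]
          linarith
  linarith [norm_sub_norm_le y (truncate hp0 w N y)]

theorem exists_lt_of_iInf_eq_zero (hw : ∀ n, 0 < w n) (hinf : iInf w = 0) {δ : ℝ} (hδ : 0 < δ)
    (N : ℕ) : ∃ n, N ≤ n ∧ w n < δ := by
  by_contra! h
  have hfin : ∃ c > 0, ∀ n < N, c ≤ w n := by
    clear h
    induction N with
    | zero => exact ⟨1, one_pos, by simp⟩
    | succ N ih =>
      obtain ⟨c, hc, hcn⟩ := ih
      refine ⟨min c (w N), lt_min hc (hw N), fun n hn => ?_⟩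
      rcases Nat.lt_succ_iff_lt_or_eq.1 hn with h | rfl
      · exact (min_le_left _ _).trans (hcn n h)
      · exact min_le_right _ _
  obtain ⟨c, hc, hcn⟩ := hfin
  have : min c δ ≤ iInf w := le_ciInf fun n => by
    rcases lt_or_ge n N with hn | hn
    · exact (min_le_left _ _).trans (hcn n hn)
    · exact (min_le_right _ _).trans (h n hn)
  exact absurd (lt_min hc hδ) (not_lt.2 (hinf ▸ this))

/-- On `n` coordinates with small enough weights the weighted `ℓ^2` norm is dominated by the `ℓ^p`
norm, so the maximum of the two is the `ℓ^p` norm. Since all weights are positive and their infimum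
is `0`, such coordinates exist beyond any `N`. -/
theorem exists_isometry_piLp (hp0 : 0 < p.toReal) (hw : ∀ n, 0 < w n) (hinf : iInf w = 0)
    (N n : ℕ) : ∃ J : PiLp p (fun _ : Fin n => 𝕜) →L[𝕜] Xpw 𝕜 p w,
      (∀ a, ‖J a‖ = ‖a‖) ∧ ∀ a, truncate hp0 w N (J a) = 0 := by
  classical
  -- This gives both `δ ≤ 1`, so that `w ^ 2 ≤ δ` when `w < δ`, and `n * δ ≤ 1`.
  set δ : ℝ := 1 / (n + 1) with hδ
  have hδ0 : 0 < δ := by positivity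
  obtain ⟨φ, hφ, hφδ⟩ := Filter.extraction_of_frequently_atTop (P := fun k => w k < δ)
    (Filter.frequently_atTop.2 fun m => by
      obtain ⟨k, h1, h2⟩ := exists_lt_of_iInf_eq_zero hw hinf hδ0 m
      exact ⟨k, h1, h2⟩)
  set k : Fin n → ℕ := fun j => φ (N + j) with hk
  have hkinj : Function.Injective k := fun i j h =>
    Fin.ext (Nat.add_left_cancel (hφ.injective h))
  have hkN : ∀ j, N ≤ k j := fun j => (Nat.le_add_right N j).trans (hφ.id_le _)
  set s : (Fin n → 𝕜) → ℕ → 𝕜 := fun a m => ∑ j, if k j = m then a j else 0 with hs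
  have hsk : ∀ a j, s a (k j) = a j := fun a j => by
    rw [hs]
    simp only [hkinj.eq_iff]
    simp
  have hs0 : ∀ a m, m ∉ Finset.univ.image k → s a m = 0 := fun a m hm =>
    Finset.sum_eq_zero fun j _ => if_neg fun h =>
      hm (Finset.mem_image.2 ⟨j, Finset.mem_univ j, h⟩)
  have hsum : ∀ (a : Fin n → 𝕜) (ψ : ℕ → 𝕜 → ℝ), (∀ m z, 0 ≤ ψ m z) → (∀ m, ψ m 0 = 0) →
      ∀ F : Finset ℕ, ∑ m ∈ F, ψ m (s a m) ≤ ∑ j, ψ (k j) (a j) := fun a ψ hψ hψ0 F => by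
    calc ∑ m ∈ F, ψ m (s a m) ≤ ∑ m ∈ F ∪ Finset.univ.image k, ψ m (s a m) :=
          Finset.sum_le_sum_of_subset_of_nonneg Finset.subset_union_left fun _ _ _ => hψ _ _
      _ = ∑ m ∈ Finset.univ.image k, ψ m (s a m) :=
          (Finset.sum_subset Finset.subset_union_right fun m _ hm => by
            rw [hs0 a m hm, hψ0]).symm
      _ = ∑ j, ψ (k j) (a j) := by
          rw [Finset.sum_image fun i _ j _ h => hkinj h]
          simp only [hsk]
  have hp1 : ∀ (a : Fin n → 𝕜) (F : Finset ℕ),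
      ∑ m ∈ F, ‖s a m‖ ^ p.toReal ≤ ∑ j, ‖a j‖ ^ p.toReal := fun a =>
    hsum a (fun _ z => ‖z‖ ^ p.toReal) (fun _ z => by positivity)
      fun _ => by rw [norm_zero, Real.zero_rpow hp0.ne']
  have hp2 : ∀ (a : Fin n → 𝕜) (F : Finset ℕ),
      ∑ m ∈ F, ‖(w m : 𝕜) * s a m‖ ^ 2 ≤ ∑ j, ‖(w (k j) : 𝕜) * a j‖ ^ 2 := fun a =>
    hsum a (fun m z => ‖(w m : 𝕜) * z‖ ^ 2) (fun _ z => by positivity) fun _ => by simp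
  set L : PiLp p (fun _ : Fin n => 𝕜) →ₗ[𝕜] Xpw 𝕜 p w :=
    { toFun := fun a => ⟨s a.ofLp, mem_xpwSubmodule_of_sum_le (hp1 a.ofLp) (hp2 a.ofLp)⟩
      map_add' := fun a b => Subtype.ext <| funext fun m => by
        change s (a + b).ofLp m = s a.ofLp m + s b.ofLp m
        rw [hs, ← Finset.sum_add_distrib]
        refine Finset.sum_congr rfl fun j _ => ?_
        split_ifs <;> simp
      map_smul' := fun c a => Subtype.ext <| funext fun m => by
        change s (c • a).ofLp m = c * s a.ofLp m
        rw [hs, Finset.mul_sum]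
        refine Finset.sum_congr rfl fun j _ => ?_
        split_ifs <;> simp } with hL
  have hLc : ∀ a m, coord m (L a) = s a.ofLp m := fun _ _ => rfl
  have hna : ∀ a : PiLp p (fun _ : Fin n => 𝕜), ‖a‖ ^ p.toReal = ∑ j, ‖a j‖ ^ p.toReal :=
    fun a => by
      rw [PiLp.norm_eq_sum hp0, ← Real.rpow_mul (Finset.sum_nonneg fun i _ => by positivity),
        one_div_mul_cancel hp0.ne', Real.rpow_one]
  have hle : ∀ a, ‖L a‖ ≤ ‖a‖ := fun a => by
    refine norm_le_of_sum_le hp0 (norm_nonneg _) _ (fun F => ?_) fun F => ?_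
    · rw [hna]
      exact hp1 a.ofLp F
    · refine (hp2 a.ofLp F).trans ?_
      calc ∑ j, ‖(w (k j) : 𝕜) * a j‖ ^ 2 ≤ ∑ _j : Fin n, δ * ‖a‖ ^ 2 := by
            refine Finset.sum_le_sum fun j _ => ?_
            have h1 : w (k j) < δ := hφδ _
            have h2 : δ ≤ 1 := by
              rw [hδ, div_le_one (by positivity)]
              linarith [Nat.cast_nonneg (α := ℝ) n]
            have h3 : w (k j) ^ 2 ≤ δ := by nlinarith [hw (k j)]
            rw [norm_mul, RCLike.norm_ofReal, mul_pow, sq_abs]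
            exact mul_le_mul h3 (pow_le_pow_left₀ (norm_nonneg _) (PiLp.norm_apply_le a j) 2)
              (by positivity) hδ0.le
        _ = (n * δ) * ‖a‖ ^ 2 := by
            rw [Finset.sum_const, Finset.card_univ, Fintype.card_fin, nsmul_eq_mul, mul_assoc]
        _ ≤ ‖a‖ ^ 2 := by
            refine mul_le_of_le_one_left (sq_nonneg _) ?_
            rw [hδ, mul_one_div, div_le_one (by positivity)]
            linarith
  have hge : ∀ a, ‖a‖ ≤ ‖L a‖ := fun a => by
    refine (Real.rpow_le_rpow_iff (norm_nonneg _) (norm_nonneg _) hp0).1 ?_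
    have h := (L a).sum_norm_coord_rpow_le hp0 (Finset.univ.image k)
    rw [Finset.sum_image fun i _ j _ h => hkinj h] at h
    simp only [hLc, hsk] at h
    rwa [hna]
  refine ⟨L.mkContinuous 1 fun a => by rw [one_mul]; exact hle a,
    fun a => le_antisymm (hle a) (hge a), fun a => ext_coord fun m => ?_⟩
  rw [coord_truncate, map_zero]
  split_ifs with hm
  · refine hs0 a.ofLp m fun h => ?_
    obtain ⟨j, _, rfl⟩ := Finset.mem_image.1 h
    exact absurd (hkN j) (not_le.2 hm)
  · rfl

end Xpw

/-! ### The `ℒ_p` property -/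

section ScriptLp

variable {𝕜 : Type*} [RCLike 𝕜] {p : ℝ≥0∞} [hp : Fact (1 ≤ p)]

theorem banachMazurDist_range_le {X : Type*} [NormedAddCommGroup X] [NormedSpace 𝕜 X] {n : ℕ}
    (G : PiLp p (fun _ : Fin n => 𝕜) →L[𝕜] X) {A B : ℝ} (hA : 0 ≤ A) (hB : 0 ≤ B)
    (h1 : ∀ a, ‖G a‖ ≤ A * ‖a‖) (h2 : ∀ a, ‖a‖ ≤ B * ‖G a‖) :
    banachMazurDist 𝕜 G.range (PiLp p fun _ : Fin (Module.finrank 𝕜 G.range) => 𝕜)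
      ≤ ENNReal.ofReal (B * A) := by
  have hinj : Function.Injective G.toLinearMap := by
    refine (injective_iff_map_eq_zero G.toLinearMap).2 fun a ha => ?_
    have h := h2 a
    change ‖a‖ ≤ B * ‖G.toLinearMap a‖ at h
    rw [ha, norm_zero, mul_zero] at h
    exact norm_le_zero_iff.1 h
  let e : PiLp p (fun _ : Fin n => 𝕜) ≃ₗ[𝕜] G.range := LinearEquiv.ofInjective G.toLinearMap hinj
  let S : PiLp p (fun _ : Fin n => 𝕜) ≃L[𝕜] G.range := e.toContinuousLinearEquiv
  have hS : ∀ a, (S a : X) = G a := fun _ => rfl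
  have hn1 : ‖(S : PiLp p (fun _ : Fin n => 𝕜) →L[𝕜] G.range)‖ ≤ A :=
    ContinuousLinearMap.opNorm_le_bound _ hA h1
  have hn2 : ‖(S.symm : G.range →L[𝕜] PiLp p (fun _ : Fin n => 𝕜))‖ ≤ B :=
    ContinuousLinearMap.opNorm_le_bound _ hB fun y => by
      have h := h2 (S.symm y)
      rw [← hS, S.apply_symm_apply] at h
      exact h
  have hfr : Module.finrank 𝕜 G.range = n := by
    rw [← e.finrank_eq, LinearEquiv.finrank_eq (WithLp.linearEquiv p 𝕜 (Fin n → 𝕜)),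
      Module.finrank_fin_fun]
  rw [hfr]
  refine (iInf_le _ S.symm).trans (ENNReal.ofReal_le_ofReal ?_)
  exact mul_le_mul hn2 hn1 (norm_nonneg _) hB

/-- The subspace sought is the range of `G = q α + J γ`: the first summand sends the part of `α` in
the complemented copy back to `X_{p,w}`, the second stores the remainder `r α = β γ` on far
coordinates. The constants `A` and `B` involve only `‖i‖` and `‖q‖`, hence are uniform in `Z`. -/
theorem isScriptLp_xpw (hp2 : 2 < p.toReal) {w : ℕ → ℝ} (hw : ∀ n, 0 < w n) (hinf : iInf w = 0) :
    IsScriptLp 𝕜 p (Xpw 𝕜 p w) := by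
  have hp0 : 0 < p.toReal := by linarith
  obtain ⟨i, q, hqi⟩ := Xpw.exists_embedding_unitMeasure (𝕜 := 𝕜) hp2 hw
  set A := 2 * (‖q‖ + 2 * (1 + ‖i‖ * ‖q‖)) with hA
  set B := 2 * (2 * ‖i‖ + 6) with hB
  have hA0 : 0 ≤ A := by positivity
  have hB0 : 0 ≤ B := by positivity
  refine ⟨max 1 (B * A), le_max_left _ _, fun Z _ => ?_⟩
  obtain ⟨n, α, hα1, hα2, hαZ⟩ :=
    exists_piLp_embedding_range_ge hp0 (Z.map i.toLinearMap)
  set r : Lp 𝕜 p unitMeasure →L[𝕜] Lp 𝕜 p unitMeasure := ContinuousLinearMap.id 𝕜 _ - i ∘L q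
    with hr
  have hrv : ∀ e, r e = e - i (q e) := fun _ => rfl
  obtain ⟨m, β, hβ1, hβ2, hβZ⟩ :=
    exists_piLp_embedding_range_ge hp0 (r ∘L α).range
  have hβinj : Function.Injective β.toLinearMap := by
    refine (injective_iff_map_eq_zero β.toLinearMap).2 fun a ha => ?_
    have h := hβ1 a
    change ‖a‖ ≤ 2 * ‖β.toLinearMap a‖ at h
    rw [ha, norm_zero, mul_zero] at h
    exact norm_le_zero_iff.1 h
  let γ : PiLp p (fun _ : Fin n => 𝕜) →ₗ[𝕜] PiLp p (fun _ : Fin m => 𝕜) :=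
    (LinearEquiv.ofInjective β.toLinearMap hβinj).symm.toLinearMap ∘ₗ
      (r ∘L α).toLinearMap.codRestrict β.range fun a => hβZ ⟨a, rfl⟩
  have hβγ : ∀ a, β (γ a) = r (α a) := fun a => by
    have h := LinearEquiv.apply_symm_apply (LinearEquiv.ofInjective β.toLinearMap hβinj)
      ((r ∘L α).toLinearMap.codRestrict β.range (fun a => hβZ ⟨a, rfl⟩) a)
    exact congrArg Subtype.val h
  -- The first `N` coordinates nearly determine the range of `q α`, and `J` is placed beyond them,
  -- so the two summands of `G` can be separated.
  obtain ⟨N, hN⟩ := Xpw.exists_norm_le_two_mul_norm_truncate hp0 (q ∘L α).range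
  obtain ⟨J, hJ1, hJ2⟩ := Xpw.exists_isometry_piLp (𝕜 := 𝕜) hp0 hw hinf N m
  set G : PiLp p (fun _ : Fin n => 𝕜) →L[𝕜] Xpw 𝕜 p w :=
    q ∘L α + J ∘L γ.toContinuousLinearMap with hG
  have hGv : ∀ a, G a = q (α a) + J (γ a) := fun _ => rfl
  have hγn : ∀ a, ‖γ a‖ ≤ 2 * ‖r (α a)‖ := fun a => hβγ a ▸ hβ1 (γ a)
  have hiq : ∀ e, ‖i (q e)‖ ≤ ‖i‖ * ‖q e‖ := fun e => i.le_opNorm _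
  have h1 : ∀ a, ‖G a‖ ≤ A * ‖a‖ := fun a => by
    have e1 := q.le_opNorm (α a)
    have e2 := hiq (α a)
    have e3 : ‖r (α a)‖ ≤ ‖α a‖ + ‖i (q (α a))‖ := hrv (α a) ▸ norm_sub_le _ _
    have e4 := mul_le_mul_of_nonneg_left e1 (norm_nonneg i)
    have e5 : ‖G a‖ ≤ (‖q‖ + 2 * (1 + ‖i‖ * ‖q‖)) * ‖α a‖ := by
      calc ‖G a‖ ≤ ‖q (α a)‖ + ‖γ a‖ := by
            rw [hGv, ← hJ1 (γ a)]
            exact norm_add_le _ _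
        _ ≤ _ := by linarith [hγn a]
    refine e5.trans ?_
    have := mul_le_mul_of_nonneg_left (hα2 a)
      (by positivity : 0 ≤ ‖q‖ + 2 * (1 + ‖i‖ * ‖q‖))
    rw [hA]
    linarith
  have h2 : ∀ a, ‖a‖ ≤ B * ‖G a‖ := fun a => by
    -- Truncating `G a` kills the `J` part and recovers `q (α a)`; subtraction then recovers `γ a`,
    -- and `α a = r (α a) + i (q (α a))` recovers `a`. Collecting the factors gives `B`.
    have e1 : ‖q (α a)‖ ≤ 2 * ‖G a‖ := by
      have h := hN (q (α a)) ⟨a, rfl⟩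
      have ht : Xpw.truncate hp0 w N (G a) = Xpw.truncate hp0 w N (q (α a)) := by
        rw [hGv, map_add, hJ2, add_zero]
      rw [← ht] at h
      linarith [Xpw.norm_truncate_le hp0 N (G a)]
    have e2 : ‖γ a‖ ≤ 3 * ‖G a‖ := by
      have : J (γ a) = G a - q (α a) := by rw [hGv, add_sub_cancel_left]
      rw [← hJ1, this]
      linarith [norm_sub_le (G a) (q (α a))]
    have e3 : ‖r (α a)‖ ≤ 2 * ‖γ a‖ := hβγ a ▸ hβ2 (γ a)
    have e4 : ‖α a‖ ≤ ‖r (α a)‖ + ‖i (q (α a))‖ := by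
      have : α a = r (α a) + i (q (α a)) := by rw [hrv, sub_add_cancel]
      nth_rewrite 1 [this]
      exact norm_add_le _ _
    have e5 := hiq (α a)
    have e6 := mul_le_mul_of_nonneg_left e1 (norm_nonneg i)
    rw [hB]
    linarith [hα1 a]
  refine ⟨G.range, inferInstance, fun z hz => ?_,
    (banachMazurDist_range_le G hA0 hB0 h1 h2).trans
      (ENNReal.ofReal_le_ofReal (le_max_right _ _))⟩
  obtain ⟨a, ha⟩ := hαZ ⟨z, hz, rfl⟩
  have ha' : α a = i z := ha
  -- On `i(Z)` the operator `r` vanishes, so nothing is stored and `G a = q (i z) = z`.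
  have hγ0 : γ a = 0 := by
    refine norm_le_zero_iff.1 ((hγn a).trans ?_)
    rw [hrv, ha', hqi, sub_self, norm_zero, mul_zero]
  refine ⟨a, ?_⟩
  change G a = z
  rw [hGv, hγ0, map_zero, add_zero, ha', hqi]

/-- If the infimum were positive, taking it as `ε` would leave an empty sum, which is not infinite.
-/
theorem ConditionStar.iInf_eq_zero {r : ℝ} {w : ℕ → ℝ} (hw : ∀ n, 0 < w n)
    (h : ConditionStar r w) : iInf w = 0 := by
  have hbdd : BddBelow (Set.range w) := ⟨0, by rintro _ ⟨n, rfl⟩; exact (hw n).le⟩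
  refine le_antisymm ?_ (le_ciInf fun n => (hw n).le)
  by_contra! hpos
  have hempty : IsEmpty {n : ℕ // w n < iInf w} :=
    ⟨fun n => absurd (ciInf_le hbdd n.1) (not_le.2 n.2)⟩
  have := h _ hpos
  rw [tsum_empty] at this
  exact ENNReal.zero_ne_top this

end ScriptLp

end

theorem corollary2p6 (𝕜 : Type*) [RCLike 𝕜] :
    (∀ (p : ℝ≥0∞) [Fact (1 ≤ p)], 2 < p → p < ∞ → ∀ w : ℕ → ℝ, (∀ n, 0 < w n) →
      IsomorphicToComplemented 𝕜 (Xpw 𝕜 p w) (Lp 𝕜 p unitMeasure) ∧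
      (iInf w = 0 → IsScriptLp 𝕜 p (Xpw 𝕜 p w)) ∧
      (ConditionStar p.toReal w → IsScriptLp 𝕜 p (Xpw 𝕜 p w))) ∧
    ∃ C : ℝ≥0∞ → ℝ, C 2 = 1 ∧ (∀ p q : ℝ≥0∞, p.HolderConjugate q → C p = C q) ∧
      ∀ (p : ℝ≥0∞) [Fact (1 ≤ p)], 1 < p → p < ∞ →
        ∀ f : ℕ → ℝ → 𝕜, (∀ n, IsSymmThreeValued (f n)) → iIndepFun f unitMeasure →
          ∃ P : Lp 𝕜 p unitMeasure →L[𝕜] Lp 𝕜 p unitMeasure,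
            P ∘L P = P ∧ P.range = closedSpan f p ∧ ‖P‖ ≤ C p ∧
            ∀ (g : Lp 𝕜 p unitMeasure) (h : Lp 𝕜 2 unitMeasure),
              (g : ℝ → 𝕜) =ᵐ[unitMeasure] h →
                (P g : ℝ → 𝕜) =ᵐ[unitMeasure] (closedSpan f 2).starProjection h := by
  refine ⟨fun p _ hp2 hpt w hw => ?_, orthoProjConst, if_pos rfl, fun p q h => orthoProjConst_eq h,
    fun p _ hp1 hpt f hf hind => ?_⟩
  · have hp2R : 2 < p.toReal := by
      simpa using (ENNReal.toReal_lt_toReal (by simp) hpt.ne).2 hp2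
    obtain ⟨U, V, hUV⟩ := Xpw.exists_embedding_unitMeasure (𝕜 := 𝕜) hp2R hw
    exact ⟨isomorphicToComplemented_of_leftInverse U V hUV, fun h => isScriptLp_xpw hp2R hw h,
      fun h => isScriptLp_xpw hp2R hw (h.iInf_eq_zero hw)⟩
  · obtain ⟨a, ha, hu⟩ := exists_isSignSystem_of_isSymmThreeValued hf hind
    obtain ⟨P, hPP, hPr, hPn, hPa⟩ := hu.exists_isOrthoProjection p hp1 hpt
    refine ⟨P, hPP, hPr.trans (closedSpan_eq_lpSpan ha hu p).symm, hPn, fun g h e => ?_⟩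
    simpa only [closedSpan_eq_lpSpan ha hu 2] using hPa g h e
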